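/- Fix $k>0$, let $\rho(x)=x^2/2$ for $|x|\le k$ and $\rho(x)=k|x|-k^2/2$ for $|x|>k$ be the Huber loss, and let $\psi(x)=\rho'(x)=\max\{\min\{x,k\},-k\}$. Let $(\mathbf x,\epsilon),(\mathbf x_1,\epsilon_1),(\mathbf x_2,\epsilon_2),\dots$ be i.i.d. with values in $\mathbb R^p\times\mathbb R$, where $\mathbf x$ has finite second moments, mean $\mu_x^*$ and positive definite covariance matrix $\Sigma_x^*$, and suppose $$y_i=\mu^*+\mathbf x_i^{T}\beta^*+\epsilon_i,\qquad \mathbb E[\psi(\epsilon)\mid\mathbf x]=0 .$$ Let $\mathcal E$ be the $\Sigma_x^*$-envelope of $\mathrm{span}(\beta^*)$, i.e. the intersection of all subspaces $R\ni\beta^*$ of $\mathbb R^p$ with $\Sigma_x^*=\mathbf P_R\Sigma_x^*\mathbf P_R+\mathbf Q_R\Sigma_x^*\mathbf Q_R$, where $\mathbf P_R$ and $\mathbf Q_R=\mathbf I-\mathbf P_R$ are the orthogonal projections onto $R$ and $R^\perp$. Let $u=\dim\mathcal E$, let $\Gamma\in\mathbb R^{p\times u}$ and $\Gamma_0\in\mathbb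 R^{p\times(p-u)}$ have orthonormal columns that form bases of $\mathcal E$ and $\mathcal E^\perp$, and write $\beta^*=\Gamma\eta$ and $\Sigma_x^*=\Gamma\Omega\Gamma^T+\Gamma_0\Omega_0\Gamma_0^T$ with $\eta\in\mathbb R^u$ and positive semidefinite $\Omega,\Omega_0$. Assume further that $\epsilon$ is independent of $\mathbf x$, that $\mathbb P(|\epsilon|=k)=0$ (so that $\psi'(\epsilon)$ is almost surely defined), and that $\mathbb E[\psi'(\epsilon)]\ne0$. For each $n$ let $(\hat\mu,\hat\eta)$ be a minimizer of $\sum_{i=1}^n\rho(y_i-\mu-\eta^T\Gamma^T\mathbf x_i)$ over $\mu\in\mathbb R,\ \eta\in\mathbb R^u$ (Huber regression on $\Gamma^T\mathbf x$ with $\Gamma$ known), and let $\hat\beta_{eh}^*=\Gamma\hat\eta$. Then $\Omega$ is positive definite and $$\sqrt n(\hat\beta_{eh}^*-\beta^*)\overset{d}{\to}N\left(0,\ \frac{\mathbb E[\psi^2(\epsilon)]}{(\mathbb E[\psi'(\epsilon)])^2}\,\Gamma\Omega^{-1}\Gamma^T\right).$$ Moreover, if for each $n$ $(\hat\mu_h,\hat\beta_h)$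 is a minimizer of $\sum_{i=1}^n\rho(y_i-\mu-\mathbf x_i^T\beta)$ over $\mu\in\mathbb R,\ \beta\in\mathbb R^p$ (usual Huber regression), then $$\sqrt n(\hat\beta_h-\beta^*)\overset{d}{\to}N\left(0,\ \frac{\mathbb E[\psi^2(\epsilon)]}{(\mathbb E[\psi'(\epsilon)])^2}\,\Sigma_x^{*-1}\right),$$ and the enveloped estimator has the smaller asymptotic covariance: $$\frac{\mathbb E[\psi^2(\epsilon)]}{(\mathbb E[\psi'(\epsilon)])^2}\,\Gamma\Omega^{-1}\Gamma^T\ \preceq\ \frac{\mathbb E[\psi^2(\epsilon)]}{(\mathbb E[\psi'(\epsilon)])^2}\,\Sigma_x^{*-1}$$ in the positive semidefinite order, and the two matrices are different whenever $u<p$ and $\mathbb E[\psi^2(\epsilon)]\neq0$. -/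

import Mathlib

open MeasureTheory ProbabilityTheory Filter
open scoped Matrix

noncomputable section

/-- The Huber loss with tuning parameter `k`. -/
def huberLoss (k x : ℝ) : ℝ :=
  if |x| ≤ k then x ^ 2 / 2 else k * |x| - k ^ 2 / 2

/-- The influence function `ψ = ρ'` of the Huber loss, i.e. `x` truncated to `[-k, k]`. -/
def huberPsi (k x : ℝ) : ℝ :=
  max (min x k) (-k)

/-- The objective of Huber regression of `y` on predictors `z ∈ ℝᵈ`, from the first `n`
observations, at intercept `m` and slope `b`. -/
def huberObjective {d : ℕ} (k : ℝ) (n : ℕ) (y : ℕ → ℝ) (z : ℕ → EuclideanSpace ℝ (Fin d))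
    (m : ℝ) (b : EuclideanSpace ℝ (Fin d)) : ℝ :=
  ∑ i ∈ Finset.range n, huberLoss k (y i - m - inner ℝ (z i) b)

/-- `(m, b)` is a solution of the Huber regression of `y` on `z` from the first `n`
observations. -/
def IsHuberFit {d : ℕ} (k : ℝ) (n : ℕ) (y : ℕ → ℝ) (z : ℕ → EuclideanSpace ℝ (Fin d))
    (m : ℝ) (b : EuclideanSpace ℝ (Fin d)) : Prop :=
  ∀ (m' : ℝ) (b' : EuclideanSpace ℝ (Fin d)),
    huberObjective k n y z m b ≤ huberObjective k n y z m' b'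

/-- A matrix applied to a Euclidean vector. -/
def matApply {a b : ℕ} (M : Matrix (Fin a) (Fin b) ℝ) (v : EuclideanSpace ℝ (Fin b)) :
    EuclideanSpace ℝ (Fin a) :=
  WithLp.toLp 2 (M *ᵥ v.ofLp)

/-- The subspace spanned by the columns of a matrix. -/
def colSpan {a b : ℕ} (M : Matrix (Fin a) (Fin b) ℝ) : Submodule ℝ (EuclideanSpace ℝ (Fin a)) :=
  Submodule.span ℝ (Set.range fun j : Fin b => WithLp.toLp 2 (fun i : Fin a => M i j))

/-- `R` is a reducing subspace of `M`: `M = P_R M P_R + Q_R M Q_R`, where `P_R` and `Q_R` are the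
orthogonal projections onto `R` and its orthogonal complement. -/
def IsReducing {p : ℕ} (M : Matrix (Fin p) (Fin p) ℝ)
    (R : Submodule ℝ (EuclideanSpace ℝ (Fin p))) : Prop :=
  Matrix.toEuclideanCLM (𝕜 := ℝ) M =
    R.starProjection * Matrix.toEuclideanCLM (𝕜 := ℝ) M * R.starProjection +
      Rᗮ.starProjection * Matrix.toEuclideanCLM (𝕜 := ℝ) M * Rᗮ.starProjection

/-- The `M`-envelope of `span β`: the intersection of all reducing subspaces of `M` that
contain `β`. -/
def predictorEnvelope {p : ℕ} (M : Matrix (Fin p) (Fin p) ℝ) (β : EuclideanSpace ℝ (Fin p)) :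
    Submodule ℝ (EuclideanSpace ℝ (Fin p)) :=
  sInf {R | IsReducing M R ∧ β ∈ R}

/-- The enveloped Huber regression model for the observations `(y i, X i)` with errors `ε i`.
`Sx` is the covariance matrix of the predictors; the generic copy `(x, ε)` is `(X 0, ε 0)`. -/
structure EnvelopedHuberModel {S : Type*} [MeasurableSpace S] (P : Measure S) {p u : ℕ} (k : ℝ)
    (X : ℕ → S → EuclideanSpace ℝ (Fin p)) (ε y : ℕ → S → ℝ)
    (μ : ℝ) (β μx : EuclideanSpace ℝ (Fin p)) (Sx : Matrix (Fin p) (Fin p) ℝ)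
    (Γ : Matrix (Fin p) (Fin u) ℝ) (Γ₀ : Matrix (Fin p) (Fin (p - u)) ℝ)
    (η : EuclideanSpace ℝ (Fin u)) (Ω : Matrix (Fin u) (Fin u) ℝ)
    (Ω₀ : Matrix (Fin (p - u)) (Fin (p - u)) ℝ) : Prop where
  measurable_X : ∀ i, Measurable (X i)
  measurable_ε : ∀ i, Measurable (ε i)
  response : ∀ i ω, y i ω = μ + inner ℝ (X i ω) β + ε i ω
  indep : iIndepFun (fun i ω => (X i ω, ε i ω)) P
  ident : ∀ i, IdentDistrib (fun ω => (X i ω, ε i ω)) (fun ω => (X 0 ω, ε 0 ω)) P P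
  -- `x ∼ (μx, Sx)` with `Sx` positive definite
  memLp_two : MemLp (X 0) 2 P
  mean_eq : ∫ ω, X 0 ω ∂P = μx
  cov_eq : ∀ a b, cov[fun ω => X 0 ω a, fun ω => X 0 ω b; P] = Sx a b
  posDef_cov : Sx.PosDef
  -- `E[ψ(ε) | x] = 0`
  condExp_psi : P[fun ω => huberPsi k (ε 0 ω) | MeasurableSpace.comap (X 0) inferInstance] =ᵐ[P] 0
  -- semi-orthogonal bases of the envelope and of its orthogonal complement
  semiorthogonal : Γᵀ * Γ = 1
  semiorthogonal₀ : Γ₀ᵀ * Γ₀ = 1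
  span_eq : colSpan Γ = predictorEnvelope Sx β
  span_eq₀ : colSpan Γ₀ = (predictorEnvelope Sx β)ᗮ
  -- envelope parametrization
  posSemidef_Ω : Ω.PosSemidef
  posSemidef_Ω₀ : Ω₀.PosSemidef
  slope_eq : β = matApply Γ η
  cov_decomp : Sx = Γ * Ω * Γᵀ + Γ₀ * Ω₀ * Γ₀ᵀ

/-- The Huber factor `E[ψ(ε)²] / (E[ψ'(ε)])²`. -/
def huberFactor {S : Type*} [MeasurableSpace S] (P : Measure S) (k : ℝ) (ε : S → ℝ) : ℝ :=
  (∫ ω, huberPsi k (ε ω) ^ 2 ∂P) / (∫ ω, deriv (huberPsi k) (ε ω) ∂P) ^ 2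

/-- `√n (b̂ₙ - β)` converges in distribution to the centred normal law with covariance `V`. -/
def SqrtNAsympNormal {S : Type*} [MeasurableSpace S] (P : Measure S) [IsProbabilityMeasure P]
    {p : ℕ} (bhat : ℕ → S → EuclideanSpace ℝ (Fin p)) (β : EuclideanSpace ℝ (Fin p))
    (V : Matrix (Fin p) (Fin p) ℝ) : Prop :=
  TendstoInDistribution (fun (n : ℕ) ω => Real.sqrt n • (bhat n ω - β)) atTop id
    (fun _ => P) (multivariateGaussian 0 V)

end

/-! Along deviations `t / √n` of the parameter, the Huber objective is `-⟪U, t⟫` plus a sum of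
nonnegative remainders, where `U` is the normalized score. Each remainder is exactly quadratic
unless the perturbation moves the residual across a kink `± k` of `ψ`. Since `|ε| ≠ k` almost
surely, the strong law shows that the kinks carry a vanishing share of the second moments, and the
remainders converge to `q ⟪t, C t⟫ / 2`, uniformly for bounded `t`, where `q = E[ψ'(ε)]` and `C` is
the second moment of the design. By convexity, uniform closeness on a ball that contains a small
sphere around the minimizer `q⁻¹ C⁻¹ U` of the limiting quadratic already traps the minimizer of the
objective inside that sphere, and the central limit theorem for `U` gives the limit law. Both
regressions are instances, with covariances `S` of `x` and `Γᵀ S Γ` of `Γᵀ x`. The difference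
`D = S⁻¹ - Γ (Γᵀ S Γ)⁻¹ Γᵀ` is positive semidefinite because `D = D S D`, and nonzero when `u < p`
because its second term has rank at most `u`. -/

noncomputable section

open scoped Topology InnerProductSpace

/-! ### The Huber loss -/

section HuberLoss

variable {k : ℝ}

theorem huberPsi_of_abs_le {x : ℝ} (h : |x| ≤ k) : huberPsi k x = x := by
  obtain ⟨hl, hr⟩ := abs_le.1 h
  rw [huberPsi, min_eq_left hr, max_eq_left hl]

theorem huberPsi_of_le {x : ℝ} (hk : 0 ≤ k) (h : k ≤ x) : huberPsi k x = k := by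
  rw [huberPsi, min_eq_right h, max_eq_left (by linarith)]

theorem huberPsi_of_le_neg {x : ℝ} (h : x ≤ -k) : huberPsi k x = -k := by
  rw [huberPsi, max_eq_right ((min_le_left _ _).trans h)]

theorem abs_huberPsi_le (hk : 0 ≤ k) (x : ℝ) : |huberPsi k x| ≤ k :=
  abs_le.2 ⟨le_max_right _ _, max_le (min_le_right _ _) (by linarith)⟩

theorem monotone_huberPsi (k : ℝ) : Monotone (huberPsi k) := fun _ _ h =>
  max_le_max (min_le_min h le_rfl) le_rfl

theorem lipschitzWith_huberPsi (k : ℝ) : LipschitzWith 1 (huberPsi k) :=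
  (LipschitzWith.id.min_const k).max_const (-k)

theorem continuous_huberPsi (k : ℝ) : Continuous (huberPsi k) :=
  (lipschitzWith_huberPsi k).continuous

theorem deriv_huberPsi_nonneg (k x : ℝ) : 0 ≤ deriv (huberPsi k) x :=
  (monotone_huberPsi k).deriv_nonneg

theorem norm_deriv_huberPsi_le_one (k x : ℝ) : ‖deriv (huberPsi k) x‖ ≤ 1 := by
  simpa using norm_deriv_le_of_lipschitz (x₀ := x) (lipschitzWith_huberPsi k)

theorem deriv_huberPsi_of_abs_lt {x : ℝ} (h : |x| < k) : deriv (huberPsi k) x = 1 := by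
  have hid : huberPsi k =ᶠ[𝓝 x] id := by
    filter_upwards [continuous_abs.continuousAt.eventually_lt_const h] with y hy
    exact huberPsi_of_abs_le hy.le
  rw [hid.deriv_eq, deriv_id]

theorem deriv_huberPsi_of_lt_abs {x : ℝ} (hk : 0 ≤ k) (h : k < |x|) :
    deriv (huberPsi k) x = 0 := by
  have hconst : ∃ c, huberPsi k =ᶠ[𝓝 x] fun _ => c := by
    rcases lt_abs.1 h with hx | hx
    · exact ⟨k, (lt_mem_nhds hx).mono fun _ hy => huberPsi_of_le hk (le_of_lt hy)⟩
    · exact ⟨-k, (gt_mem_nhds (lt_neg_of_lt_neg hx)).mono fun _ hy =>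
        huberPsi_of_le_neg (le_of_lt hy)⟩
  obtain ⟨c, hc⟩ := hconst
  rw [hc.deriv_eq, deriv_const]

/-- The Huber loss is the convex conjugate of `a ↦ a² / 2` restricted to `[-k, k]`, attained at
`a = ψ(x)`. -/
theorem huberLoss_eq (hk : 0 ≤ k) (x : ℝ) :
    huberLoss k x = huberPsi k x * x - huberPsi k x ^ 2 / 2 := by
  unfold huberLoss
  split_ifs with h
  · rw [huberPsi_of_abs_le h]; ring
  · rcases lt_abs.1 (not_le.1 h) with hx | hx
    · rw [huberPsi_of_le hk hx.le, abs_of_nonneg (by linarith)]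
    · rw [huberPsi_of_le_neg (by linarith), abs_of_nonpos (by linarith)]; ring

theorem mul_sub_sq_le_huberLoss {a : ℝ} (ha : |a| ≤ k) (x : ℝ) :
    a * x - a ^ 2 / 2 ≤ huberLoss k x := by
  unfold huberLoss
  split_ifs with h
  · nlinarith [sq_nonneg (a - x)]
  · have hax : a * x ≤ |a| * |x| := by rw [← abs_mul]; exact le_abs_self _
    rw [← sq_abs a]
    nlinarith [mul_nonneg (sub_nonneg.2 ha) (sub_nonneg.2 (not_le.1 h).le), sq_nonneg (k - |a|)]

theorem huberLoss_add_huberPsi_mul_le (hk : 0 ≤ k) (x y : ℝ) :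
    huberLoss k x + huberPsi k x * (y - x) ≤ huberLoss k y := by
  have := mul_sub_sq_le_huberLoss (abs_huberPsi_le hk x) y
  rw [huberLoss_eq hk x]
  linarith

theorem convexOn_huberLoss (hk : 0 ≤ k) : ConvexOn ℝ Set.univ (huberLoss k) := by
  refine ⟨convex_univ, fun x _ y _ a b ha hb hab => ?_⟩
  have hx := mul_le_mul_of_nonneg_left (huberLoss_add_huberPsi_mul_le hk (a • x + b • y) x) ha
  have hy := mul_le_mul_of_nonneg_left (huberLoss_add_huberPsi_mul_le hk (a • x + b • y) y) hb
  obtain rfl : b = 1 - a := by linarith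
  simp only [smul_eq_mul] at *
  linarith

/-- The remainder `ρ(e - h) - ρ(e) + ψ(e) h` of the first-order expansion of the Huber loss `ρ`
at `e`. -/
def huberRemainder (k e h : ℝ) : ℝ :=
  huberLoss k (e - h) - huberLoss k e + huberPsi k e * h

theorem huberRemainder_nonneg (hk : 0 ≤ k) (e h : ℝ) : 0 ≤ huberRemainder k e h := by
  have := huberLoss_add_huberPsi_mul_le hk e (e - h)
  unfold huberRemainder
  linarith

theorem huberRemainder_le_sq (hk : 0 ≤ k) (e h : ℝ) : huberRemainder k e h ≤ h ^ 2 := by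
  have hsub := huberLoss_add_huberPsi_mul_le hk (e - h) e
  have hlip : |huberPsi k e - huberPsi k (e - h)| ≤ |h| := by
    simpa [Real.dist_eq] using (lipschitzWith_huberPsi k).dist_le_mul e (e - h)
  calc huberRemainder k e h ≤ (huberPsi k e - huberPsi k (e - h)) * h := by
        unfold huberRemainder; linarith
    _ ≤ |huberPsi k e - huberPsi k (e - h)| * |h| := by rw [← abs_mul]; exact le_abs_self _
    _ ≤ h ^ 2 := by rw [← sq_abs h, sq]; gcongr

theorem huberRemainder_eq_of_abs_lt (hk : 0 ≤ k) {e h : ℝ} (hh : |h| < |(|e| - k)|) :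
    huberRemainder k e h = deriv (huberPsi k) e * (h ^ 2 / 2) := by
  have htri : |e - h| ≤ |e| + |h| := abs_sub e h
  obtain ⟨hh₁, hh₂⟩ := abs_le.1 (le_refl |h|)
  rw [huberRemainder, huberLoss_eq hk, huberLoss_eq hk]
  rcases lt_abs.1 hh with hlt | hlt
  · have hke : k < |e| := by linarith
    rw [deriv_huberPsi_of_lt_abs hk hke]
    rcases lt_abs.1 hke with he | he
    · rw [abs_of_pos (hk.trans_lt he)] at hlt
      rw [huberPsi_of_le hk he.le, huberPsi_of_le hk (by linarith)]
      ring
    · rw [abs_of_neg (neg_pos.1 (hk.trans_lt he))] at hlt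
      rw [huberPsi_of_le_neg (by linarith), huberPsi_of_le_neg (by linarith)]
      ring
  · rw [deriv_huberPsi_of_abs_lt (by linarith), huberPsi_of_abs_le (by linarith),
      huberPsi_of_abs_le (by linarith)]
    ring

theorem abs_huberRemainder_sub_le (hk : 0 ≤ k) (e h : ℝ) :
    |huberRemainder k e h - deriv (huberPsi k) e * (h ^ 2 / 2)| ≤ h ^ 2 := by
  have hd := norm_deriv_huberPsi_le_one k e
  rw [Real.norm_of_nonneg (deriv_huberPsi_nonneg k e)] at hd
  have hupper : deriv (huberPsi k) e * (h ^ 2 / 2) ≤ 1 * (h ^ 2 / 2) := by gcongr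
  have hlower : 0 ≤ deriv (huberPsi k) e * (h ^ 2 / 2) :=
    mul_nonneg (deriv_huberPsi_nonneg k e) (by positivity)
  rw [abs_le]
  constructor <;> linarith [huberRemainder_nonneg hk e h, huberRemainder_le_sq hk e h, sq_nonneg h]

end HuberLoss

/-! ### Minimizers of approximately quadratic convex functions -/

section Argmin

variable {F : Type*}

theorem exists_norm_sub_eq_and_le_of_convexOn [NormedAddCommGroup F] [NormedSpace ℝ F]
    {A : F → ℝ} (hA : ConvexOn ℝ Set.univ A) {b x : F} (hx : A x ≤ A b) {r : ℝ} (hr : 0 < r)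
    (hrx : r ≤ ‖x - b‖) : ∃ s, ‖s - b‖ = r ∧ A s ≤ A b := by
  have hpos : 0 < ‖x - b‖ := hr.trans_le hrx
  have ha₀ : 0 ≤ r / ‖x - b‖ := by positivity
  have ha₁ : r / ‖x - b‖ ≤ 1 := (div_le_one hpos).2 hrx
  refine ⟨b + (r / ‖x - b‖) • (x - b), ?_, ?_⟩
  · rw [add_sub_cancel_left, norm_smul, Real.norm_of_nonneg ha₀, div_mul_cancel₀ _ hpos.ne']
  · have hseg := hA.2 (Set.mem_univ b) (Set.mem_univ x) (sub_nonneg.2 ha₁) ha₀ (by ring)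
    rw [show (1 - r / ‖x - b‖) • b + (r / ‖x - b‖) • x = b + (r / ‖x - b‖) • (x - b) by module,
      smul_eq_mul, smul_eq_mul] at hseg
    nlinarith

variable [NormedAddCommGroup F] [InnerProductSpace ℝ F]

theorem inner_map_self_sub_eq {V : F →ₗ[ℝ] F} (hV : V.IsSymmetric) (b s : F) :
    ⟪s - b, V (s - b)⟫_ℝ = ⟪s, V s⟫_ℝ - 2 * ⟪V b, s⟫_ℝ + ⟪V b, b⟫_ℝ := by
  simp only [map_sub, inner_sub_left, inner_sub_right]
  rw [← hV b s, real_inner_comm (V b) s, real_inner_comm (V b) b]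
  ring

/-- Convexity confines the minimizer: on the sphere of radius `r` around the minimizer `b` of the
quadratic function, `A` exceeds `A b` by at least `c r² / 2 - 2 δ > 0`. -/
theorem norm_argmin_sub_le {A : F → ℝ} (hA : ConvexOn ℝ Set.univ A) {V : F →ₗ[ℝ] F} {c : ℝ}
    (hV : V.IsSymmetric) (hc : ∀ t, c * ‖t‖ ^ 2 ≤ ⟪t, V t⟫_ℝ) {b x : F} (hx : A x ≤ A b)
    {R r δ : ℝ} (hr : 0 < r) (happ : ∀ t, ‖t‖ ≤ R → |A t + ⟪V b, t⟫_ℝ - ⟪t, V t⟫_ℝ / 2| ≤ δ)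
    (hR : ‖b‖ + r ≤ R) (hδ : 4 * δ < c * r ^ 2) : ‖x - b‖ ≤ r := by
  by_contra! hlt
  obtain ⟨s, hsr, hs⟩ := exists_norm_sub_eq_and_le_of_convexOn hA hx hr hlt.le
  have hsR : ‖s‖ ≤ R := by linarith [norm_le_norm_add_norm_sub' s b]
  have happ_s := abs_le.1 (happ s hsR)
  have happ_b := abs_le.1 (happ b (by linarith))
  have hcoer := hc (s - b)
  rw [hsr, inner_map_self_sub_eq hV] at hcoer
  have hb : ⟪b, V b⟫_ℝ = ⟪V b, b⟫_ℝ := real_inner_comm _ _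
  linarith [happ_s.1, happ_b.2]

end Argmin

/-! ### The local Huber objective -/

section LocalObjective

variable {F : Type*} [NormedAddCommGroup F] {k : ℝ}

/-- The second moment `‖v‖²` of the observation `(v, e)` if a perturbation of `e` by `c ‖v‖` can
reach a kink `± k` of `ψ`, and zero otherwise. It bounds the error of the quadratic expansion. -/
def kinkMass (k c : ℝ) : F × ℝ → ℝ :=
  {x : F × ℝ | |(|x.2| - k)| ≤ c * ‖x.1‖}.indicator fun x => ‖x.1‖ ^ 2

theorem kinkMass_nonneg (k c : ℝ) (x : F × ℝ) : 0 ≤ kinkMass k c x :=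
  Set.indicator_nonneg (fun _ _ => by positivity) x

theorem norm_kinkMass_le (k c : ℝ) (x : F × ℝ) : ‖kinkMass k c x‖ ≤ ‖x.1‖ ^ 2 := by
  rw [Real.norm_of_nonneg (kinkMass_nonneg k c x)]
  exact Set.indicator_le_self' (fun _ _ => by positivity) x

variable [InnerProductSpace ℝ F]

/-- The Huber objective as a function of the deviation `t` from the true parameter, rescaled by
`√n` and normalized to vanish at `t = 0`. -/
def localHuber (k : ℝ) (e : ℕ → ℝ) (v : ℕ → F) (n : ℕ) (t : F) : ℝ :=
  ∑ i ∈ Finset.range n, (huberLoss k (e i - (√n)⁻¹ * ⟪v i, t⟫_ℝ) - huberLoss k (e i))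

/-- The normalized score `n^{-1/2} ∑ ψ(eᵢ) vᵢ`. -/
def huberScore (k : ℝ) (e : ℕ → ℝ) (v : ℕ → F) (n : ℕ) : F :=
  (√n)⁻¹ • ∑ i ∈ Finset.range n, huberPsi k (e i) • v i

/-- The Hessian `ψ'(e) v ⊗ v` contributed by the observation `(v, e)`. -/
def huberHessian (k : ℝ) (x : F × ℝ) : F →L[ℝ] F :=
  deriv (huberPsi k) x.2 • InnerProductSpace.rankOne ℝ x.1 x.1

theorem inner_huberHessian (k : ℝ) (x : F × ℝ) (t : F) :
    ⟪t, huberHessian k x t⟫_ℝ = deriv (huberPsi k) x.2 * ⟪x.1, t⟫_ℝ ^ 2 := by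
  rw [huberHessian, smul_apply, InnerProductSpace.rankOne_apply, inner_smul_right,
    inner_smul_right, real_inner_comm]
  ring

theorem norm_huberHessian_le (k : ℝ) (x : F × ℝ) : ‖huberHessian k x‖ ≤ ‖x.1‖ ^ 2 := by
  rw [huberHessian, norm_smul, InnerProductSpace.norm_rankOne, ← sq]
  exact mul_le_of_le_one_left (by positivity) (norm_deriv_huberPsi_le_one k x.2)

theorem convexOn_localHuber (hk : 0 ≤ k) (e : ℕ → ℝ) (v : ℕ → F) (n : ℕ) :
    ConvexOn ℝ Set.univ (localHuber k e v n) := by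
  refine ⟨convex_univ, fun x _ y _ a b ha hb hab => ?_⟩
  simp only [localHuber, smul_eq_mul, Finset.mul_sum, ← Finset.sum_add_distrib]
  refine Finset.sum_le_sum fun i _ => ?_
  have hloss := (convexOn_huberLoss hk).2 (Set.mem_univ (e i - (√n)⁻¹ * ⟪v i, x⟫_ℝ))
    (Set.mem_univ (e i - (√n)⁻¹ * ⟪v i, y⟫_ℝ)) ha hb hab
  obtain rfl : b = 1 - a := by linarith
  have haffine : e i - (√n)⁻¹ * ⟪v i, a • x + (1 - a) • y⟫_ℝ =
      a • (e i - (√n)⁻¹ * ⟪v i, x⟫_ℝ) + (1 - a) • (e i - (√n)⁻¹ * ⟪v i, y⟫_ℝ) := by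
    simp only [inner_add_right, real_inner_smul_right, smul_eq_mul]
    ring
  rw [haffine]
  simp only [smul_eq_mul] at *
  linarith

theorem localHuber_add_inner_huberScore (k : ℝ) (e : ℕ → ℝ) (v : ℕ → F) (n : ℕ) (t : F) :
    localHuber k e v n t + ⟪huberScore k e v n, t⟫_ℝ =
      ∑ i ∈ Finset.range n, huberRemainder k (e i) ((√n)⁻¹ * ⟪v i, t⟫_ℝ) := by
  simp only [localHuber, huberScore, huberRemainder, real_inner_smul_left, sum_inner,
    Finset.mul_sum, ← Finset.sum_add_distrib]
  refine Finset.sum_congr rfl fun i _ => ?_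
  ring

theorem abs_huberRemainder_sub_inner_huberHessian_le (hk : 0 ≤ k) {a c R : ℝ} (ha : 0 ≤ a)
    (hac : a * R ≤ c) (x : F × ℝ) {t : F} (ht : ‖t‖ ≤ R) :
    |huberRemainder k x.2 (a * ⟪x.1, t⟫_ℝ) - a ^ 2 * (⟪t, huberHessian k x t⟫_ℝ / 2)| ≤
      a ^ 2 * (R ^ 2 * kinkMass k c x) := by
  have hinner : |⟪x.1, t⟫_ℝ| ≤ R * ‖x.1‖ :=
    (abs_real_inner_le_norm _ _).trans (by rw [mul_comm]; gcongr)
  have hstep : |a * ⟪x.1, t⟫_ℝ| ≤ c * ‖x.1‖ := by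
    rw [abs_mul, abs_of_nonneg ha]
    calc a * |⟪x.1, t⟫_ℝ| ≤ a * (R * ‖x.1‖) := by gcongr
      _ = a * R * ‖x.1‖ := by ring
      _ ≤ c * ‖x.1‖ := by gcongr
  have hquad : a ^ 2 * (⟪t, huberHessian k x t⟫_ℝ / 2) =
      deriv (huberPsi k) x.2 * ((a * ⟪x.1, t⟫_ℝ) ^ 2 / 2) := by
    rw [inner_huberHessian]; ring
  rw [hquad]
  by_cases hx : |(|x.2| - k)| ≤ c * ‖x.1‖
  · rw [kinkMass, Set.indicator_of_mem (by exact hx)]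
    calc _ ≤ (a * ⟪x.1, t⟫_ℝ) ^ 2 := abs_huberRemainder_sub_le hk _ _
      _ = a ^ 2 * |⟪x.1, t⟫_ℝ| ^ 2 := by rw [mul_pow, sq_abs]
      _ ≤ a ^ 2 * (R * ‖x.1‖) ^ 2 := by gcongr
      _ = a ^ 2 * (R ^ 2 * ‖x.1‖ ^ 2) := by ring
  · rw [huberRemainder_eq_of_abs_lt hk (hstep.trans_lt (not_le.1 hx)), sub_self, abs_zero]
    have := kinkMass_nonneg k c x
    positivity

theorem abs_localHuber_sub_quadratic_le (hk : 0 ≤ k) (e : ℕ → ℝ) (v : ℕ → F) {n : ℕ} {c R : ℝ}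
    (hn : (√n)⁻¹ * R ≤ c) {t : F} (ht : ‖t‖ ≤ R) :
    |localHuber k e v n t + ⟪huberScore k e v n, t⟫_ℝ -
        ⟪t, ((n : ℝ)⁻¹ • ∑ i ∈ Finset.range n, huberHessian k (v i, e i)) t⟫_ℝ / 2| ≤
      R ^ 2 * ((n : ℝ)⁻¹ • ∑ i ∈ Finset.range n, kinkMass k c (v i, e i)) := by
  have hinv : ((√(n : ℝ))⁻¹) ^ 2 = (n : ℝ)⁻¹ := by rw [inv_pow, Real.sq_sqrt n.cast_nonneg]
  have hquad : ⟪t, ((n : ℝ)⁻¹ • ∑ i ∈ Finset.range n, huberHessian k (v i, e i)) t⟫_ℝ / 2 =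
      ∑ i ∈ Finset.range n, ((√(n : ℝ))⁻¹) ^ 2 * (⟪t, huberHessian k (v i, e i) t⟫_ℝ / 2) := by
    rw [hinv, smul_apply, sum_apply, inner_smul_right, inner_sum, ← Finset.mul_sum,
      ← Finset.sum_div, mul_div_assoc]
  have hmass : R ^ 2 * ((n : ℝ)⁻¹ • ∑ i ∈ Finset.range n, kinkMass k c (v i, e i)) =
      ∑ i ∈ Finset.range n, ((√(n : ℝ))⁻¹) ^ 2 * (R ^ 2 * kinkMass k c (v i, e i)) := by
    rw [hinv, ← Finset.mul_sum, ← Finset.mul_sum, smul_eq_mul, mul_left_comm]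
  rw [localHuber_add_inner_huberScore, hquad, hmass, ← Finset.sum_sub_distrib]
  exact (Finset.abs_sum_le_sum_abs _ _).trans <| Finset.sum_le_sum fun i _ =>
    abs_huberRemainder_sub_inner_huberHessian_le hk (by positivity) hn (v i, e i) ht

theorem tendstoUniformlyOn_inner_map_self {ι : Type*} {l : Filter ι} {W : ι → F →L[ℝ] F}
    {V : F →L[ℝ] F} (hW : Tendsto W l (𝓝 V)) (R : ℝ) :
    TendstoUniformlyOn (fun n t => ⟪t, W n t⟫_ℝ) (fun t => ⟪t, V t⟫_ℝ) l
      (Metric.closedBall 0 R) := by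
  have hnorm : Tendsto (fun n => R ^ 2 * ‖W n - V‖) l (𝓝 0) := by
    simpa using (tendsto_iff_norm_sub_tendsto_zero.1 hW).const_mul (R ^ 2)
  rw [Metric.tendstoUniformlyOn_iff]
  intro δ hδ
  filter_upwards [hnorm.eventually_lt_const hδ] with n hn t ht
  have htR : ‖t‖ ≤ R := by simpa using ht
  rw [dist_comm, Real.dist_eq, ← inner_sub_right, ← sub_apply]
  calc |⟪t, (W n - V) t⟫_ℝ| ≤ ‖t‖ * (‖W n - V‖ * ‖t‖) :=
        (abs_real_inner_le_norm _ _).trans (by gcongr; exact (W n - V).le_opNorm t)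
    _ = ‖t‖ ^ 2 * ‖W n - V‖ := by ring
    _ ≤ R ^ 2 * ‖W n - V‖ := by gcongr
    _ < δ := hn

/-- On a ball of radius `R` the residuals are perturbed by at most `R ‖vᵢ‖ / √n`, so for each `M`
the observations near a kink eventually carry at most the mass `ℓ M`. -/
theorem tendstoUniformlyOn_localHuber (hk : 0 ≤ k) {e : ℕ → ℝ} {v : ℕ → F} {V : F →L[ℝ] F}
    {ℓ : ℕ → ℝ}
    (hV : Tendsto (fun n : ℕ => (n : ℝ)⁻¹ • ∑ i ∈ Finset.range n, huberHessian k (v i, e i))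
      atTop (𝓝 V))
    (hℓ : ∀ M : ℕ, Tendsto (fun n : ℕ => (n : ℝ)⁻¹ • ∑ i ∈ Finset.range n,
      kinkMass k (1 / ((M : ℝ) + 1)) (v i, e i)) atTop (𝓝 (ℓ M)))
    (hℓ₀ : Tendsto ℓ atTop (𝓝 0)) (R : ℝ) :
    TendstoUniformlyOn (fun n t => localHuber k e v n t + ⟪huberScore k e v n, t⟫_ℝ)
      (fun t => ⟪t, V t⟫_ℝ / 2) atTop (Metric.closedBall 0 R) := by
  rw [Metric.tendstoUniformlyOn_iff]
  intro δ hδ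
  have hR₀ : Tendsto (fun M => R ^ 2 * ℓ M) atTop (𝓝 0) := by simpa using hℓ₀.const_mul (R ^ 2)
  obtain ⟨M, hM⟩ := (hR₀.eventually_lt_const (half_pos hδ)).exists
  have hscale : Tendsto (fun n : ℕ => (√(n : ℝ))⁻¹ * R) atTop (𝓝 0) := by
    simpa using ((Real.tendsto_sqrt_atTop.comp tendsto_natCast_atTop_atTop).inv_tendsto_atTop
      |>.mul_const R)
  filter_upwards [((hℓ M).const_mul (R ^ 2)).eventually_lt_const hM,
    hscale.eventually_le_const (Nat.one_div_pos_of_nat (n := M)),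
    Metric.tendstoUniformlyOn_iff.1 (tendstoUniformlyOn_inner_map_self hV R) δ hδ]
    with n hmass hn hquad t ht
  have hlocal := abs_le.1 (abs_localHuber_sub_quadratic_le hk e v hn (t := t) (by simpa using ht))
  have hHess := abs_lt.1 (hquad t ht)
  rw [Real.dist_eq, abs_lt]
  constructor <;> linarith [hlocal.1, hlocal.2, hHess.1, hHess.2]

end LocalObjective

/-! ### Second moments -/

section SecondMoment

variable {S F : Type*} [MeasurableSpace S] {P : Measure S} [NormedAddCommGroup F]
  [InnerProductSpace ℝ F] {w : S → F}

/-- The uncentred second moment operator `E[w ⊗ w]` of a random vector. -/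
def secondMoment (P : Measure S) (w : S → F) : F →L[ℝ] F :=
  ∫ ω, InnerProductSpace.rankOne ℝ (w ω) (w ω) ∂P

theorem continuous_rankOne_self : Continuous fun x : F => InnerProductSpace.rankOne ℝ x x :=
  (InnerProductSpace.rankOne ℝ).continuous.clm_apply continuous_id

theorem integrable_rankOne_self (hw : MemLp w 2 P) :
    Integrable (fun ω => InnerProductSpace.rankOne ℝ (w ω) (w ω)) P := by
  refine (hw.integrable_norm_pow two_ne_zero).mono'
    (continuous_rankOne_self.comp_aestronglyMeasurable hw.aestronglyMeasurable) (.of_forall ?_)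
  intro ω
  rw [InnerProductSpace.norm_rankOne, ← sq]

theorem inner_secondMoment [CompleteSpace F] (hw : MemLp w 2 P) (s t : F) :
    ⟪s, secondMoment P w t⟫_ℝ = ∫ ω, ⟪s, w ω⟫_ℝ * ⟪w ω, t⟫_ℝ ∂P := by
  have hint := integrable_rankOne_self hw
  rw [secondMoment, ContinuousLinearMap.integral_apply hint,
    ← integral_inner (hint.apply_continuousLinearMap t)]
  simp only [InnerProductSpace.rankOne_apply, inner_smul_right, mul_comm]

theorem inner_secondMoment_self [CompleteSpace F] (hw : MemLp w 2 P) (t : F) :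
    ⟪t, secondMoment P w t⟫_ℝ = ∫ ω, ⟪w ω, t⟫_ℝ ^ 2 ∂P := by
  simp only [inner_secondMoment hw, real_inner_comm, sq]

theorem isSymmetric_secondMoment [CompleteSpace F] (hw : MemLp w 2 P) :
    (secondMoment P w : F →ₗ[ℝ] F).IsSymmetric := fun s t => by
  rw [ContinuousLinearMap.coe_coe, real_inner_comm, inner_secondMoment hw, inner_secondMoment hw]
  simp only [real_inner_comm, mul_comm]

theorem inner_secondMoment_pos [CompleteSpace F] (hw : MemLp w 2 P) {C : F ≃L[ℝ] F}
    (hC : secondMoment P w = C) {t : F} (ht : t ≠ 0) : 0 < ⟪t, secondMoment P w t⟫_ℝ := by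
  rw [inner_secondMoment_self hw]
  refine (integral_nonneg fun ω => sq_nonneg _).lt_of_ne' fun hzero => ht ?_
  have hae := (integral_eq_zero_iff_of_nonneg (fun ω => sq_nonneg _)
    (hw.inner_const t).integrable_sq).1 hzero
  refine C.map_eq_zero_iff.1 (ext_inner_left ℝ fun s => ?_)
  rw [inner_zero_right, ← ContinuousLinearEquiv.coe_coe, ← hC, inner_secondMoment hw]
  refine integral_eq_zero_of_ae ?_
  filter_upwards [hae] with ω hω
  rw [pow_eq_zero_iff two_ne_zero |>.1 hω, mul_zero, Pi.zero_apply]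

theorem exists_coercive_of_pos [FiniteDimensional ℝ F] {V : F →L[ℝ] F}
    (hV : ∀ t, t ≠ 0 → 0 < ⟪t, V t⟫_ℝ) : ∃ c : ℝ, 0 < c ∧ ∀ t, c * ‖t‖ ^ 2 ≤ ⟪t, V t⟫_ℝ := by
  rcases subsingleton_or_nontrivial F with hF | hF
  · exact ⟨1, one_pos, fun t => by simp [Subsingleton.elim t 0]⟩
  obtain ⟨x, hx, hmin⟩ := (isCompact_sphere (0 : F) 1).exists_isMinOn
    (NormedSpace.sphere_nonempty.2 zero_le_one) (f := fun t => ⟪t, V t⟫_ℝ) (by fun_prop)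
  refine ⟨⟪x, V x⟫_ℝ, hV x (ne_zero_of_mem_unit_sphere ⟨x, hx⟩), fun t => ?_⟩
  rcases eq_or_ne t 0 with rfl | ht
  · simp
  have hle : ⟪x, V x⟫_ℝ ≤ ⟪‖t‖⁻¹ • t, V (‖t‖⁻¹ • t)⟫_ℝ :=
    hmin (by simp [norm_smul, norm_ne_zero_iff.2 ht])
  have hhom : ⟪‖t‖⁻¹ • t, V (‖t‖⁻¹ • t)⟫_ℝ = ⟪t, V t⟫_ℝ / ‖t‖ ^ 2 := by
    rw [map_smul, real_inner_smul_left, real_inner_smul_right]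
    field_simp
  rwa [hhom, le_div_iff₀ (by positivity)] at hle

end SecondMoment

/-! ### Limits in distribution -/

section Limits

variable {S : Type*} [MeasurableSpace S] {P : Measure S}
  {F : Type*} [NormedAddCommGroup F] [MeasurableSpace F] [BorelSpace F]
  {E : Type*} [NormedAddCommGroup E] [MeasurableSpace E] [BorelSpace E]

theorem charFun_map_continuousLinearMap [InnerProductSpace ℝ F] [CompleteSpace F]
    [SecondCountableTopology F] [InnerProductSpace ℝ E] [CompleteSpace E]
    [SecondCountableTopology E] (T : F →L[ℝ] E) {Y : S → F} (hY : AEMeasurable Y P) (t : E) :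
    charFun (P.map fun ω => T (Y ω)) t = charFun (P.map Y) (T.adjoint t) := by
  rw [charFun_apply, charFun_apply, integral_map (by fun_prop) (by fun_prop),
    integral_map hY (by fun_prop)]
  simp only [ContinuousLinearMap.adjoint_inner_right]

theorem tendsto_charFun_inv_sqrt_smul_sum [IsProbabilityMeasure P] [InnerProductSpace ℝ F]
    [CompleteSpace F] [SecondCountableTopology F] {W : ℕ → S → F} (hL2 : MemLp (W 0) 2 P)
    (hmean : ∫ ω, W 0 ω ∂P = 0) (hindep : iIndepFun W P)
    (hident : ∀ i, IdentDistrib (W i) (W 0) P P) (t : F) :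
    Tendsto (fun n : ℕ => charFun (P.map fun ω => (√n)⁻¹ • ∑ i ∈ Finset.range n, W i ω) t) atTop
      (𝓝 (Complex.exp (-(⟪t, secondMoment P (W 0) t⟫_ℝ : ℂ) / 2))) := by
  have hW : ∀ i, AEMeasurable (W i) P := fun i => (hident i).aemeasurable_fst
  have hinner : Measurable fun x : F => ⟪t, x⟫_ℝ := by fun_prop
  have hL2t : MemLp (fun ω => ⟪t, W 0 ω⟫_ℝ) 2 P := hL2.const_inner t
  have hmeant : ∫ ω, ⟪t, W 0 ω⟫_ℝ ∂P = 0 := by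
    rw [integral_inner (hL2.integrable one_le_two), hmean, inner_zero_right]
  have hvar : Var[fun ω => ⟪t, W 0 ω⟫_ℝ; P] = ⟪t, secondMoment P (W 0) t⟫_ℝ := by
    rw [variance_of_integral_eq_zero hL2t.aestronglyMeasurable.aemeasurable hmeant,
      inner_secondMoment_self hL2]
    simp only [real_inner_comm]
  have hclt := tendstoInDistribution_inv_sqrt_mul_sum_sub (P := P)
    (X := fun i ω => ⟪t, W i ω⟫_ℝ) (Y := id)
    (P' := gaussianReal 0 Var[fun ω => ⟪t, W 0 ω⟫_ℝ; P].toNNReal) HasLaw.id hL2t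
    (hindep.comp (fun _ x => ⟪t, x⟫_ℝ) fun _ => hinner) (fun i => (hident i).comp hinner)
  have hchar := ProbabilityMeasure.tendsto_iff_tendsto_charFun.1 hclt.tendsto 1
  simp only [ProbabilityMeasure.coe_mk, Measure.map_id, charFun_gaussianReal,
    hmeant] at hchar
  convert hchar using 2 with n
  · have hsum : AEMeasurable (fun ω => (√n)⁻¹ • ∑ i ∈ Finset.range n, W i ω) P := by fun_prop
    have hproj := charFun_map_continuousLinearMap (innerSL ℝ t) hsum 1
    rw [ContinuousLinearMap.adjoint_innerSL_apply, ContinuousLinearMap.toSpanSingleton_apply,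
      one_smul] at hproj
    rw [← hproj]
    simp only [innerSL_apply_apply, inner_smul_right, inner_sum, mul_zero, sub_zero]
  · rw [← hvar, Real.coe_toNNReal _ (variance_nonneg _ _)]
    congr 1
    push_cast
    ring

theorem exists_forall_measure_lt_norm_le [ProperSpace F] {U : ℕ → S → F}
    (hU : ∀ n, AEMeasurable (U n) P) (htight : IsTightMeasureSet (Set.range fun n => P.map (U n)))
    {δ : ENNReal} (hδ : 0 < δ) : ∃ R : ℝ, ∀ n, P {ω | R < ‖U n ω‖} ≤ δ := by
  obtain ⟨R, hR⟩ := (ENNReal.tendsto_nhds_zero.1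
    (isTightMeasureSet_iff_tendsto_measure_norm_gt.1 htight) δ hδ).exists
  refine ⟨R, fun n => ?_⟩
  calc P {ω | R < ‖U n ω‖} = P.map (U n) {x | R < ‖x‖} :=
        (Measure.map_apply_of_aemeasurable (hU n)
          (measurableSet_lt measurable_const measurable_norm)).symm
    _ ≤ ⨆ μ ∈ Set.range fun n => P.map (U n), μ {x | R < ‖x‖} :=
        le_iSup₂ (f := fun (μ : Measure F) _ => μ {x | R < ‖x‖}) _ ⟨n, rfl⟩
    _ ≤ δ := hR

/-- It suffices that `D n → 0` almost surely along the bounded values of a tight sequence. -/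
theorem tendstoInMeasure_zero_of_isTightMeasureSet [IsFiniteMeasure P] [SecondCountableTopology E]
    [ProperSpace F] {D : ℕ → S → E} {U : ℕ → S → F}
    (hD : ∀ n, AEMeasurable (D n) P) (hU : ∀ n, AEMeasurable (U n) P)
    (htight : IsTightMeasureSet (Set.range fun n => P.map (U n)))
    (h : ∀ᵐ ω ∂P, ∀ R r : ℝ, 0 < r → ∀ᶠ n in atTop, ‖U n ω‖ ≤ R → ‖D n ω‖ ≤ r) :
    TendstoInMeasure P D atTop 0 := by
  intro r hr
  rw [ENNReal.tendsto_nhds_zero]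
  intro δ hδ
  have hδ₂ : 0 < δ / 2 := ENNReal.half_pos hδ.ne'
  obtain ⟨R, hR⟩ := exists_forall_measure_lt_norm_le hU htight hδ₂
  let D' : ℕ → S → E := fun n => {ω | ‖U n ω‖ ≤ R}.indicator (D n)
  have hD' : TendstoInMeasure P D' atTop 0 := by
    refine tendstoInMeasure_of_tendsto_ae (fun n => ?_) ?_
    · exact ((hD n).indicator₀ (nullMeasurableSet_le (hU n).norm
        aemeasurable_const)).aestronglyMeasurable
    · filter_upwards [h] with ω hω
      rw [Metric.tendsto_nhds]
      intro a ha
      filter_upwards [hω R (a / 2) (half_pos ha)] with n hn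
      rw [Pi.zero_apply, dist_zero_right]
      by_cases hn' : ‖U n ω‖ ≤ R
      · simpa [D', hn'] using (hn hn').trans_lt (half_lt_self ha)
      · simpa [D', hn'] using ha
  filter_upwards [ENNReal.tendsto_nhds_zero.1 (hD' r hr) (δ / 2) hδ₂] with n hn
  have hsubset : {ω | r ≤ edist (D n ω) 0} ⊆ {ω | r ≤ edist (D' n ω) 0} ∪ {ω | R < ‖U n ω‖} := by
    intro ω hω
    rcases le_or_gt ‖U n ω‖ R with hle | hlt
    · exact .inl (by simpa [D', hle] using hω)
    · exact .inr hlt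
  calc P {ω | r ≤ edist (D n ω) 0}
      ≤ P {ω | r ≤ edist (D' n ω) 0} + P {ω | R < ‖U n ω‖} :=
        (measure_mono hsubset).trans (measure_union_le _ _)
    _ ≤ δ / 2 + δ / 2 := add_le_add hn (hR n)
    _ = δ := ENNReal.add_halves δ

end Limits

/-! ### Random designs -/

section RandomDesign

variable {S F : Type*} [MeasurableSpace S] {P : Measure S} [NormedAddCommGroup F]
  [MeasurableSpace F] {v : ℕ → S → F} {e : ℕ → S → ℝ} {k : ℝ}

/-- The pairs `(vᵢ, eᵢ)` of predictors and errors are i.i.d., and the predictors are square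
integrable and independent of the errors. -/
structure IsRandomDesign (P : Measure S) (v : ℕ → S → F) (e : ℕ → S → ℝ) : Prop where
  iIndepFun : iIndepFun (fun i ω => (v i ω, e i ω)) P
  identDistrib : ∀ i, IdentDistrib (fun ω => (v i ω, e i ω)) (fun ω => (v 0 ω, e 0 ω)) P P
  memLp_two : MemLp (v 0) 2 P
  indepFun : IndepFun (v 0) (e 0) P

theorem measurable_kinkMass [OpensMeasurableSpace F] (k c : ℝ) :
    Measurable (kinkMass k c : F × ℝ → ℝ) :=
  Measurable.indicator (by fun_prop) (measurableSet_le (by fun_prop) (by fun_prop))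

namespace IsRandomDesign

theorem aemeasurable_predictor (h : IsRandomDesign P v e) (i : ℕ) : AEMeasurable (v i) P :=
  (h.identDistrib i).aemeasurable_fst.fst

theorem aemeasurable_error (h : IsRandomDesign P v e) (i : ℕ) : AEMeasurable (e i) P :=
  (h.identDistrib i).aemeasurable_fst.snd

theorem map {E : Type*} [NormedAddCommGroup E] [MeasurableSpace E] (h : IsRandomDesign P v e)
    {g : F → E} (hg : Measurable g) (hL2 : MemLp (fun ω => g (v 0 ω)) 2 P) :
    IsRandomDesign P (fun i ω => g (v i ω)) e where
  iIndepFun := h.iIndepFun.comp (fun _ => Prod.map g id) fun _ => hg.prodMap measurable_id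
  identDistrib i := (h.identDistrib i).comp (hg.prodMap measurable_id)
  memLp_two := hL2
  indepFun := h.indepFun.comp hg measurable_id

theorem ae_tendsto_average {G : Type*} [NormedAddCommGroup G] [NormedSpace ℝ G] [CompleteSpace G]
    [MeasurableSpace G] [BorelSpace G] (h : IsRandomDesign P v e) {g : F × ℝ → G}
    (hg : Measurable g) (hint : Integrable (fun ω => g (v 0 ω, e 0 ω)) P) :
    ∀ᵐ ω ∂P, Tendsto (fun n : ℕ => (n : ℝ)⁻¹ • ∑ i ∈ Finset.range n, g (v i ω, e i ω)) atTop
      (𝓝 (∫ ω, g (v 0 ω, e 0 ω) ∂P)) :=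
  strong_law_ae (fun i ω => g (v i ω, e i ω)) hint
    (fun _ _ hij => (h.iIndepFun.comp (fun _ => g) fun _ => hg).indepFun hij)
    fun i => (h.identDistrib i).comp hg

theorem integrable_kinkMass [OpensMeasurableSpace F] (h : IsRandomDesign P v e) (c : ℝ) :
    Integrable (fun ω => kinkMass k c (v 0 ω, e 0 ω)) P :=
  h.memLp_two.integrable_norm_pow two_ne_zero |>.mono'
    ((measurable_kinkMass k c).comp_aemeasurable
      (h.identDistrib 0).aemeasurable_fst).aestronglyMeasurable
    (.of_forall fun _ => norm_kinkMass_le k c _)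

theorem tendsto_integral_kinkMass [OpensMeasurableSpace F] (h : IsRandomDesign P v e)
    (hatom : ∀ᵐ ω ∂P, |e 0 ω| ≠ k) :
    Tendsto (fun M : ℕ => ∫ ω, kinkMass k (1 / ((M : ℝ) + 1)) (v 0 ω, e 0 ω) ∂P) atTop (𝓝 0) := by
  rw [← integral_zero S ℝ (μ := P)]
  refine tendsto_integral_of_dominated_convergence _
    (fun M => (h.integrable_kinkMass _).aestronglyMeasurable)
    (h.memLp_two.integrable_norm_pow two_ne_zero) (fun M => .of_forall fun _ => norm_kinkMass_le ..)
    ?_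
  filter_upwards [hatom] with ω hω
  have hdist : 0 < |(|e 0 ω| - k)| := abs_pos.2 (sub_ne_zero.2 hω)
  have hradius : Tendsto (fun M : ℕ => 1 / ((M : ℝ) + 1) * ‖v 0 ω‖) atTop (𝓝 0) := by
    simpa using tendsto_one_div_add_atTop_nhds_zero_nat.mul_const ‖v 0 ω‖
  refine tendsto_const_nhds.congr' ?_
  filter_upwards [hradius.eventually_lt_const hdist] with M hM
  exact .symm <| Set.indicator_of_notMem (by exact not_le.2 hM) _

variable [InnerProductSpace ℝ F] [FiniteDimensional ℝ F] [BorelSpace F]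

theorem integral_smul {G : Type*} [NormedAddCommGroup G] [NormedSpace ℝ G]
    (h : IsRandomDesign P v e) {f : ℝ → ℝ} {g : F → G} (hf : Measurable f) (hg : Continuous g) :
    ∫ ω, f (e 0 ω) • g (v 0 ω) ∂P = (∫ ω, f (e 0 ω) ∂P) • ∫ ω, g (v 0 ω) ∂P :=
  h.indepFun.symm.integral_fun_comp_smul_comp (h.aemeasurable_error 0)
    (h.aemeasurable_predictor 0) hf.aestronglyMeasurable hg.aestronglyMeasurable

theorem integral_huberHessian (h : IsRandomDesign P v e) :
    ∫ ω, huberHessian k (v 0 ω, e 0 ω) ∂P =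
      (∫ ω, deriv (huberPsi k) (e 0 ω) ∂P) • secondMoment P (v 0) :=
  h.integral_smul (measurable_deriv _) continuous_rankOne_self

theorem memLp_huberPsi_smul (h : IsRandomDesign P v e) (hk : 0 ≤ k) :
    MemLp (fun ω => huberPsi k (e 0 ω) • v 0 ω) 2 P := by
  refine MemLp.of_le_mul (c := k) h.memLp_two
    (((continuous_huberPsi k).measurable.comp_aemeasurable (h.aemeasurable_error 0)).smul
      (h.aemeasurable_predictor 0)).aestronglyMeasurable (.of_forall fun ω => ?_)
  rw [norm_smul]
  gcongr
  exact abs_huberPsi_le hk _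

theorem integral_huberPsi_smul (h : IsRandomDesign P v e)
    (hpsi : ∫ ω, huberPsi k (e 0 ω) ∂P = 0) : ∫ ω, huberPsi k (e 0 ω) • v 0 ω ∂P = 0 := by
  refine (h.integral_smul (continuous_huberPsi k).measurable continuous_id).trans ?_
  rw [hpsi, zero_smul]

theorem secondMoment_huberPsi_smul (h : IsRandomDesign P v e) :
    secondMoment P (fun ω => huberPsi k (e 0 ω) • v 0 ω) =
      (∫ ω, huberPsi k (e 0 ω) ^ 2 ∂P) • secondMoment P (v 0) := by
  refine .trans ?_ (h.integral_smul (f := fun x => huberPsi k x ^ 2)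
    ((continuous_huberPsi k).pow 2).measurable continuous_rankOne_self)
  simp only [secondMoment, map_smul, smul_apply, smul_smul, sq]

theorem ae_tendsto_huberHessian (h : IsRandomDesign P v e) :
    ∀ᵐ ω ∂P, Tendsto (fun n : ℕ => (n : ℝ)⁻¹ • ∑ i ∈ Finset.range n,
      huberHessian k (v i ω, e i ω)) atTop
      (𝓝 ((∫ ω, deriv (huberPsi k) (e 0 ω) ∂P) • secondMoment P (v 0))) := by
  have hmeas : Measurable (huberHessian k : F × ℝ → F →L[ℝ] F) :=
    Measurable.smul ((measurable_deriv (huberPsi k)).comp measurable_snd)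
      ((continuous_rankOne_self (F := F)).measurable.comp measurable_fst)
  rw [← h.integral_huberHessian]
  refine h.ae_tendsto_average hmeas <| h.memLp_two.integrable_norm_pow two_ne_zero |>.mono'
    (hmeas.comp_aemeasurable (h.identDistrib 0).aemeasurable_fst).aestronglyMeasurable
    (.of_forall fun ω => norm_huberHessian_le k _)

theorem ae_tendstoUniformlyOn_localHuber (h : IsRandomDesign P v e) (hk : 0 ≤ k)
    (hatom : ∀ᵐ ω ∂P, |e 0 ω| ≠ k) :
    ∀ᵐ ω ∂P, ∀ R, TendstoUniformlyOn
      (fun n t => localHuber k (e · ω) (v · ω) n t + ⟪huberScore k (e · ω) (v · ω) n, t⟫_ℝ)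
      (fun t => ⟪t, ((∫ ω, deriv (huberPsi k) (e 0 ω) ∂P) • secondMoment P (v 0)) t⟫_ℝ / 2) atTop
      (Metric.closedBall 0 R) := by
  filter_upwards [h.ae_tendsto_huberHessian, ae_all_iff.2 fun M : ℕ =>
    h.ae_tendsto_average (measurable_kinkMass k (1 / ((M : ℝ) + 1))) (h.integrable_kinkMass _)]
    with ω hHess hkink
  exact tendstoUniformlyOn_localHuber hk hHess hkink (h.tendsto_integral_kinkMass hatom)

/-- The quadratic approximation of the local objective has the minimizer
`E[ψ'(e)]⁻¹ E[v ⊗ v]⁻¹ U` for the score `U`. -/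
theorem ae_eventually_norm_argmin_sub_le (h : IsRandomDesign P v e) (hk : 0 ≤ k)
    (hatom : ∀ᵐ ω ∂P, |e 0 ω| ≠ k) (hderiv : ∫ ω, deriv (huberPsi k) (e 0 ω) ∂P ≠ 0)
    {C : F ≃L[ℝ] F} (hC : secondMoment P (v 0) = C) :
    ∀ᵐ ω ∂P, ∀ R r : ℝ, 0 < r → ∀ᶠ n : ℕ in atTop, ∀ that : F,
      (∀ t, localHuber k (e · ω) (v · ω) n that ≤ localHuber k (e · ω) (v · ω) n t) →
      ‖huberScore k (e · ω) (v · ω) n‖ ≤ R →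
      ‖that - (∫ ω, deriv (huberPsi k) (e 0 ω) ∂P)⁻¹ •
        C.symm (huberScore k (e · ω) (v · ω) n)‖ ≤ r := by
  set q := ∫ ω, deriv (huberPsi k) (e 0 ω) ∂P
  have hq₀ : 0 < q := (integral_nonneg fun _ => deriv_huberPsi_nonneg k _).lt_of_ne' hderiv
  obtain ⟨c, hc, hcoercive⟩ :=
    exists_coercive_of_pos fun _ => inner_secondMoment_pos h.memLp_two hC
  have hsymm : ((q • secondMoment P (v 0) : F →L[ℝ] F) : F →ₗ[ℝ] F).IsSymmetric :=
    (isSymmetric_secondMoment h.memLp_two).smul rfl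
  have hcoercive' : ∀ t, q * c * ‖t‖ ^ 2 ≤ ⟪t, (q • secondMoment P (v 0)) t⟫_ℝ := fun t => by
    rw [mul_assoc, smul_apply, real_inner_smul_right]
    gcongr
    exact hcoercive t
  let G : F →L[ℝ] F := q⁻¹ • (C.symm : F →L[ℝ] F)
  have hG : ∀ U, (q • secondMoment P (v 0)) (G U) = U := fun U => by
    simp [G, hC, smul_smul, hq₀.ne']
  filter_upwards [h.ae_tendstoUniformlyOn_localHuber hk hatom] with ω happ R r hr
  have hδ : 0 < q * c * r ^ 2 / 8 := by positivity
  filter_upwards [Metric.tendstoUniformlyOn_iff.1 (happ (‖G‖ * R + r)) _ hδ] with n hn that hmin hU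
  refine norm_argmin_sub_le (convexOn_localHuber hk _ _ n) hsymm hcoercive'
    (b := G (huberScore k (e · ω) (v · ω) n)) (hmin _) hr (R := ‖G‖ * R + r)
    (δ := q * c * r ^ 2 / 8) (fun t ht => ?_) ?_ (by linarith)
  · have hlt := hn t (by simpa using ht)
    rw [dist_comm, Real.dist_eq] at hlt
    rw [ContinuousLinearMap.coe_coe, hG]
    exact hlt.le
  · gcongr
    exact (G.le_opNorm _).trans (by gcongr)

theorem aemeasurable_huberScore (h : IsRandomDesign P v e) (k : ℝ) (n : ℕ) :
    AEMeasurable (fun ω => huberScore k (e · ω) (v · ω) n) P := by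
  have hψ := (continuous_huberPsi k).measurable
  have hv := h.aemeasurable_predictor
  have he := h.aemeasurable_error
  unfold huberScore
  fun_prop

theorem tendsto_charFun_huberScore [IsProbabilityMeasure P] (h : IsRandomDesign P v e)
    (hk : 0 ≤ k) (hpsi : ∫ ω, huberPsi k (e 0 ω) ∂P = 0) (t : F) :
    Tendsto (fun n => charFun (P.map fun ω => huberScore k (e · ω) (v · ω) n) t) atTop
      (𝓝 (Complex.exp (-(((∫ ω, huberPsi k (e 0 ω) ^ 2 ∂P) *
        ⟪t, secondMoment P (v 0) t⟫_ℝ : ℝ) : ℂ) / 2))) := by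
  have hterm : Measurable fun x : F × ℝ => huberPsi k x.2 • x.1 :=
    ((continuous_huberPsi k).measurable.comp measurable_snd).smul measurable_fst
  have hclt := tendsto_charFun_inv_sqrt_smul_sum (W := fun i ω => huberPsi k (e i ω) • v i ω)
    (h.memLp_huberPsi_smul hk) (h.integral_huberPsi_smul hpsi) (h.iIndepFun.comp _ fun _ => hterm)
    (fun i => (h.identDistrib i).comp hterm) t
  rwa [h.secondMoment_huberPsi_smul, smul_apply, real_inner_smul_right] at hclt

theorem isTightMeasureSet_huberScore [IsProbabilityMeasure P] (h : IsRandomDesign P v e)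
    (hk : 0 ≤ k) (hpsi : ∫ ω, huberPsi k (e 0 ω) ∂P = 0) :
    IsTightMeasureSet (Set.range fun n => P.map fun ω => huberScore k (e · ω) (v · ω) n) :=
  have := fun n => Measure.isProbabilityMeasure_map (h.aemeasurable_huberScore k n)
  isTightMeasureSet_of_tendsto_charFun (by fun_prop) (h.tendsto_charFun_huberScore hk hpsi)

variable {E : Type*} [NormedAddCommGroup E] [InnerProductSpace ℝ E] [FiniteDimensional ℝ E]
  [MeasurableSpace E] [BorelSpace E]

theorem tendstoInDistribution_map_huberScore [IsProbabilityMeasure P] (h : IsRandomDesign P v e)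
    (hk : 0 ≤ k) (hpsi : ∫ ω, huberPsi k (e 0 ω) ∂P = 0) {C : F ≃L[ℝ] F}
    (hC : secondMoment P (v 0) = C) (T : F →L[ℝ] E) {ν : Measure E} [IsProbabilityMeasure ν]
    (hν : ∀ t, charFun ν t = Complex.exp (-(((∫ ω, huberPsi k (e 0 ω) ^ 2 ∂P) *
      ⟪T.adjoint t, C (T.adjoint t)⟫_ℝ : ℝ) : ℂ) / 2)) :
    TendstoInDistribution (fun n ω => T (huberScore k (e · ω) (v · ω) n)) atTop id (fun _ => P)
      ν := by
  refine ⟨fun n => T.measurable.comp_aemeasurable (h.aemeasurable_huberScore k n),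
    aemeasurable_id, ProbabilityMeasure.tendsto_iff_tendsto_charFun.2 fun t => ?_⟩
  simp only [ProbabilityMeasure.coe_mk, Measure.map_id, hν,
    charFun_map_continuousLinearMap T (h.aemeasurable_huberScore k _)]
  have hscore := h.tendsto_charFun_huberScore hk hpsi (T.adjoint t)
  rwa [hC] at hscore

/-- Only the linear image `L (that n)` has to be measurable, which allows for a nuisance intercept
without any measurability. -/
theorem tendstoInDistribution_map_argmin [IsProbabilityMeasure P] (h : IsRandomDesign P v e)
    (hk : 0 ≤ k) (hatom : ∀ᵐ ω ∂P, |e 0 ω| ≠ k) (hpsi : ∫ ω, huberPsi k (e 0 ω) ∂P = 0)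
    (hderiv : ∫ ω, deriv (huberPsi k) (e 0 ω) ∂P ≠ 0) {C : F ≃L[ℝ] F}
    (hC : secondMoment P (v 0) = C) {that : ℕ → S → F} (hthat : ∀ᵐ ω ∂P, ∀ n t,
      localHuber k (e · ω) (v · ω) n (that n ω) ≤ localHuber k (e · ω) (v · ω) n t)
    (L : F →L[ℝ] E) (hmeas : ∀ n, AEMeasurable (fun ω => L (that n ω)) P) {ν : Measure E}
    [IsProbabilityMeasure ν] (hν : ∀ t, charFun ν t = Complex.exp
      (-((huberFactor P k (e 0) * ⟪L.adjoint t, C.symm (L.adjoint t)⟫_ℝ : ℝ) : ℂ) / 2)) :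
    TendstoInDistribution (fun n ω => L (that n ω)) atTop id (fun _ => P) ν := by
  set q := ∫ ω, deriv (huberPsi k) (e 0 ω) ∂P with hq
  let G : F →L[ℝ] F := q⁻¹ • (C.symm : F →L[ℝ] F)
  have hGC : ∀ x, G (C x) = q⁻¹ • x := fun x => by simp [G]
  have hcov : ∀ t, (∫ ω, huberPsi k (e 0 ω) ^ 2 ∂P) *
      ⟪(L ∘L G).adjoint t, C ((L ∘L G).adjoint t)⟫_ℝ =
      huberFactor P k (e 0) * ⟪L.adjoint t, C.symm (L.adjoint t)⟫_ℝ := fun t => by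
    rw [ContinuousLinearMap.adjoint_comp, ContinuousLinearMap.comp_apply,
      ContinuousLinearMap.adjoint_inner_left, hGC, real_inner_smul_right,
      ContinuousLinearMap.adjoint_inner_right, real_inner_comm]
    simp only [G, smul_apply, ContinuousLinearEquiv.coe_coe, real_inner_smul_right, huberFactor,
      ← hq]
    ring
  have hscore := h.tendstoInDistribution_map_huberScore hk hpsi hC (L ∘L G) (ν := ν) fun t => by
    rw [hν, hcov]
  refine tendstoInDistribution_of_tendstoInMeasure_sub _ _ hscore ?_ hmeas
  refine tendstoInMeasure_zero_of_isTightMeasureSet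
    (fun n => (hmeas n).sub (hscore.forall_aemeasurable n)) (h.aemeasurable_huberScore k)
    (h.isTightMeasureSet_huberScore hk hpsi) ?_
  filter_upwards [h.ae_eventually_norm_argmin_sub_le hk hatom hderiv hC, hthat]
    with ω hlin hmin R r hr
  filter_upwards [hlin R (r / (‖L‖ + 1)) (by positivity)] with n hn hU
  calc ‖L (that n ω) - (L ∘L G) (huberScore k (e · ω) (v · ω) n)‖
      = ‖L (that n ω - G (huberScore k (e · ω) (v · ω) n))‖ := by
        rw [map_sub, ContinuousLinearMap.comp_apply]
    _ ≤ (‖L‖ + 1) * (r / (‖L‖ + 1)) := by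
        refine (L.le_opNorm _).trans ?_
        gcongr
        exacts [by linarith, hn _ (hmin n) hU]
    _ = r := by field_simp

end IsRandomDesign

end RandomDesign

/-! ### Matrices acting on Euclidean vectors -/

section MatApply

variable {a b c : ℕ}

theorem matApply_matApply (M : Matrix (Fin a) (Fin b) ℝ) (N : Matrix (Fin b) (Fin c) ℝ)
    (x : EuclideanSpace ℝ (Fin c)) : matApply M (matApply N x) = matApply (M * N) x := by
  simp [matApply]

theorem matApply_one (x : EuclideanSpace ℝ (Fin a)) :
    matApply (1 : Matrix (Fin a) (Fin a) ℝ) x = x := by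
  simp [matApply]

theorem inner_matApply_left (M : Matrix (Fin a) (Fin b) ℝ) (x : EuclideanSpace ℝ (Fin b))
    (s : EuclideanSpace ℝ (Fin a)) : ⟪matApply M x, s⟫_ℝ = ⟪x, matApply Mᵀ s⟫_ℝ := by
  simp only [matApply, EuclideanSpace.inner_eq_star_dotProduct, star_trivial]
  rw [Matrix.mulVec_transpose, Matrix.dotProduct_mulVec]

theorem inner_matApply_right (M : Matrix (Fin a) (Fin b) ℝ) (s : EuclideanSpace ℝ (Fin a))
    (x : EuclideanSpace ℝ (Fin b)) : ⟪s, matApply M x⟫_ℝ = ⟪matApply Mᵀ s, x⟫_ℝ := by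
  rw [inner_matApply_left, Matrix.transpose_transpose]

/-- `matApply M` as a continuous linear map. -/
def matApplyL (M : Matrix (Fin a) (Fin b) ℝ) :
    EuclideanSpace ℝ (Fin b) →L[ℝ] EuclideanSpace ℝ (Fin a) :=
  LinearMap.toContinuousLinearMap
    { toFun := matApply M
      map_add' := fun x y => by simp [matApply, Matrix.mulVec_add]
      map_smul' := fun r x => by simp [matApply, Matrix.mulVec_smul] }

theorem matApplyL_apply (M : Matrix (Fin a) (Fin b) ℝ) (x : EuclideanSpace ℝ (Fin b)) :
    matApplyL M x = matApply M x :=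
  rfl

theorem adjoint_matApplyL (M : Matrix (Fin a) (Fin b) ℝ) :
    (matApplyL M).adjoint = matApplyL Mᵀ :=
  .symm <| (ContinuousLinearMap.eq_adjoint_iff _ _).2 fun x s => by
    rw [matApplyL_apply, matApplyL_apply, inner_matApply_left, Matrix.transpose_transpose]

/-- The invertible operator `matApply M` of a nonsingular matrix `M`. -/
def matApplyEquiv (M : Matrix (Fin a) (Fin a) ℝ) (hM : IsUnit M.det) :
    EuclideanSpace ℝ (Fin a) ≃L[ℝ] EuclideanSpace ℝ (Fin a) :=
  .equivOfInverse (matApplyL M) (matApplyL M⁻¹)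
    (fun x => by
      rw [matApplyL_apply, matApplyL_apply, matApply_matApply, Matrix.nonsing_inv_mul _ hM,
        matApply_one])
    (fun x => by
      rw [matApplyL_apply, matApplyL_apply, matApply_matApply, Matrix.mul_nonsing_inv _ hM,
        matApply_one])

theorem matApplyEquiv_symm_apply {M : Matrix (Fin a) (Fin a) ℝ} (hM : IsUnit M.det)
    (x : EuclideanSpace ℝ (Fin a)) : (matApplyEquiv M hM).symm x = matApply M⁻¹ x :=
  rfl

theorem charFun_multivariateGaussian_zero {V : Matrix (Fin a) (Fin a) ℝ} (hV : V.PosSemidef)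
    (t : EuclideanSpace ℝ (Fin a)) :
    charFun (multivariateGaussian 0 V) t =
      Complex.exp (-((⟪t, matApply V t⟫_ℝ : ℝ) : ℂ) / 2) := by
  rw [charFun_multivariateGaussian hV, inner_zero_right, matApply,
    EuclideanSpace.inner_eq_star_dotProduct, star_trivial, dotProduct_comm]
  congr 1
  push_cast
  ring

theorem covariance_inner_inner {S : Type*} [MeasurableSpace S] {P : Measure S}
    [IsProbabilityMeasure P] {X : S → EuclideanSpace ℝ (Fin a)} (hX : MemLp X 2 P)
    {Sx : Matrix (Fin a) (Fin a) ℝ}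
    (hcov : ∀ i j, cov[fun ω => X ω i, fun ω => X ω j; P] = Sx i j)
    (s t : EuclideanSpace ℝ (Fin a)) :
    cov[fun ω => ⟪s, X ω⟫_ℝ, fun ω => ⟪t, X ω⟫_ℝ; P] = ⟪s, matApply Sx t⟫_ℝ := by
  have hcoord : ∀ (r : EuclideanSpace ℝ (Fin a)) i, MemLp (fun ω => r i * X ω i) 2 P :=
    fun r i => ((EuclideanSpace.proj (𝕜 := ℝ) i).comp_memLp' hX).const_mul (r i)
  simp only [PiLp.inner_apply, RCLike.inner_apply, conj_trivial, mul_comm (X _ _)]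
  rw [covariance_fun_sum_fun_sum (hcoord s) (hcoord t)]
  simp only [covariance_const_mul_left, covariance_const_mul_right, hcov, matApply,
    Matrix.mulVec, dotProduct, Finset.sum_mul]
  exact Finset.sum_congr rfl fun i _ => Finset.sum_congr rfl fun j _ => by ring

end MatApply

/-! ### Regression with an intercept -/

section Intercept

variable {S E : Type*} [MeasurableSpace S] {P : Measure S} [NormedAddCommGroup E]

/-- The predictor `(1, z - m)` of a regression on `z` with an intercept, centred at `m`. -/
def designPoint (m z : E) : WithLp 2 (ℝ × E) :=
  WithLp.toLp 2 (1, z - m)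

theorem measurable_designPoint [MeasurableSpace E] [BorelSpace E] (m : E) :
    Measurable (designPoint m) :=
  (WithLp.measurable_toLp 2 _).comp (by fun_prop)

theorem memLp_designPoint [IsFiniteMeasure P] {z : S → E} (hz : MemLp z 2 P) (m : E) :
    MemLp (fun ω => designPoint m (z ω)) 2 P :=
  MemLp.of_fst_of_snd_prodLp ⟨memLp_const 1, hz.sub (memLp_const m)⟩

variable [InnerProductSpace ℝ E]

theorem inner_designPoint (m z : E) (t : WithLp 2 (ℝ × E)) :
    ⟪t, designPoint m z⟫_ℝ = t.fst + (⟪t.snd, z⟫_ℝ - ⟪t.snd, m⟫_ℝ) := by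
  simp [designPoint, WithLp.prod_inner_apply, inner_sub_right]

/-- The block diagonal operator `(a, b) ↦ (a, T b)`. -/
def interceptBlock (T : E ≃L[ℝ] E) : WithLp 2 (ℝ × E) ≃L[ℝ] WithLp 2 (ℝ × E) :=
  (WithLp.prodContinuousLinearEquiv 2 ℝ ℝ E).trans
    (((ContinuousLinearEquiv.refl ℝ ℝ).prodCongr T).trans
      (WithLp.prodContinuousLinearEquiv 2 ℝ ℝ E).symm)

theorem interceptBlock_apply (T : E ≃L[ℝ] E) (t : WithLp 2 (ℝ × E)) :
    interceptBlock T t = WithLp.toLp 2 (t.fst, T t.snd) :=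
  rfl

theorem interceptBlock_symm_apply (T : E ≃L[ℝ] E) (t : WithLp 2 (ℝ × E)) :
    (interceptBlock T).symm t = WithLp.toLp 2 (t.fst, T.symm t.snd) :=
  rfl

variable [CompleteSpace E]

theorem adjoint_sndL_apply (x : E) :
    (WithLp.sndL 2 ℝ ℝ E).adjoint x = WithLp.toLp 2 (0, x) :=
  ext_inner_right ℝ fun t => by
    simp [ContinuousLinearMap.adjoint_inner_left, WithLp.prod_inner_apply]

-- Centring makes the intercept orthogonal to the slopes, whence the block structure.
theorem secondMoment_designPoint [IsProbabilityMeasure P] {z : S → E} (hz : MemLp z 2 P)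
    {T : E ≃L[ℝ] E}
    (hT : ∀ s t, cov[fun ω => ⟪s, z ω⟫_ℝ, fun ω => ⟪t, z ω⟫_ℝ; P] = ⟪s, T t⟫_ℝ) :
    secondMoment P (fun ω => designPoint (∫ ω, z ω ∂P) (z ω)) = interceptBlock T := by
  set m := ∫ ω, z ω ∂P with hm
  have hv := memLp_designPoint hz m
  have hint : ∀ s : E, Integrable (fun ω => ⟪s, z ω⟫_ℝ) P :=
    fun s => (hz.const_inner s).integrable one_le_two
  have hint_sub : ∀ s : E, Integrable (fun ω => ⟪s, z ω⟫_ℝ - ⟪s, m⟫_ℝ) P :=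
    fun s => (hint s).sub (integrable_const _)
  have hmean : ∀ s, ∫ ω, ⟪s, designPoint m (z ω)⟫_ℝ ∂P = s.fst := fun s => by
    simp only [inner_designPoint]
    rw [integral_add (integrable_const _) (hint_sub _), integral_sub (hint _) (integrable_const _),
      integral_inner (hz.integrable one_le_two)]
    simp [hm]
  have hcov : ∀ s t, cov[fun ω => ⟪s, designPoint m (z ω)⟫_ℝ,
      fun ω => ⟪t, designPoint m (z ω)⟫_ℝ; P] = ⟪s.snd, T t.snd⟫_ℝ := fun s t => by
    simp only [inner_designPoint]
    rw [covariance_const_add_left (hint_sub _), covariance_const_add_right (hint_sub _),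
      covariance_sub_const_left (hint _), covariance_sub_const_right (hint _), hT]
  refine ContinuousLinearMap.ext fun t => ext_inner_left ℝ fun s => ?_
  calc ⟪s, secondMoment P (fun ω => designPoint m (z ω)) t⟫_ℝ
      = ∫ ω, ⟪s, designPoint m (z ω)⟫_ℝ * ⟪t, designPoint m (z ω)⟫_ℝ ∂P := by
        simp only [inner_secondMoment hv, real_inner_comm t]
    _ = ⟪s.snd, T t.snd⟫_ℝ + s.fst * t.fst := by
        rw [← sub_eq_iff_eq_add, ← hmean s, ← hmean t, ← hcov s t]
        exact (covariance_eq_sub (hv.const_inner s) (hv.const_inner t)).symm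
    _ = ⟪s, interceptBlock T t⟫_ℝ := by
        rw [interceptBlock_apply, WithLp.prod_inner_apply]
        simp [mul_comm, add_comm]

end Intercept

/-! ### Asymptotic normality of Huber regression -/

section Regression

variable {d : ℕ} {k μ : ℝ} {β : EuclideanSpace ℝ (Fin d)}

/-- The deviation of the fit `(a, b)` from the parameter `(μ, β)`, rescaled by `√n`. The
intercept is shifted to account for the centring of `designPoint m`. -/
def localParam (m : EuclideanSpace ℝ (Fin d)) (μ : ℝ) (β : EuclideanSpace ℝ (Fin d)) (n : ℕ)
    (a : ℝ) (b : EuclideanSpace ℝ (Fin d)) : WithLp 2 (ℝ × EuclideanSpace ℝ (Fin d)) :=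
  √n • WithLp.toLp 2 (a - μ + ⟪m, b - β⟫_ℝ, b - β)

theorem localHuber_localParam {n : ℕ} {y e : ℕ → ℝ} {z : ℕ → EuclideanSpace ℝ (Fin d)}
    (hy : ∀ i, y i = μ + ⟪z i, β⟫_ℝ + e i) (m : EuclideanSpace ℝ (Fin d)) (a : ℝ)
    (b : EuclideanSpace ℝ (Fin d)) :
    localHuber k e (fun i => designPoint m (z i)) n (localParam m μ β n a b) =
      huberObjective k n y z a b - huberObjective k n y z μ β := by
  rw [localHuber, huberObjective, huberObjective, ← Finset.sum_sub_distrib]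
  refine Finset.sum_congr rfl fun i hi => ?_
  have hn : (n : ℝ) ≠ 0 := Nat.cast_ne_zero.2 (Finset.ne_empty_of_mem hi <| by simp [·])
  have hdev : (√n)⁻¹ * ⟪designPoint m (z i), localParam m μ β n a b⟫_ℝ =
      a - μ + ⟪z i, b - β⟫_ℝ := by
    rw [localParam, real_inner_smul_right, inv_mul_cancel_left₀ (by positivity), real_inner_comm,
      inner_designPoint]
    simp only [WithLp.toLp_fst, WithLp.toLp_snd, real_inner_comm (b - β)]
    ring
  rw [hdev, hy, inner_sub_right]
  congr 2 <;> ring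

theorem exists_localParam_eq {n : ℕ} (hn : n ≠ 0) (m : EuclideanSpace ℝ (Fin d)) (μ : ℝ)
    (β : EuclideanSpace ℝ (Fin d)) (t : WithLp 2 (ℝ × EuclideanSpace ℝ (Fin d))) :
    ∃ a b, localParam m μ β n a b = t := by
  have hsqrt : √(n : ℝ) ≠ 0 := by positivity
  refine ⟨μ + ((√n)⁻¹ * t.fst - ⟪m, (√n)⁻¹ • t.snd⟫_ℝ), β + (√n)⁻¹ • t.snd, ?_⟩
  simp only [localParam, add_sub_cancel_left, sub_add_cancel]
  refine WithLp.ofLp_injective 2 (Prod.ext ?_ ?_)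
  · exact mul_inv_cancel_left₀ hsqrt _
  · exact smul_inv_smul₀ hsqrt _

theorem IsHuberFit.localHuber_le {n : ℕ} {y e : ℕ → ℝ} {z : ℕ → EuclideanSpace ℝ (Fin d)}
    {a : ℝ} {b : EuclideanSpace ℝ (Fin d)} (hfit : IsHuberFit k n y z a b)
    (hy : ∀ i, y i = μ + ⟪z i, β⟫_ℝ + e i) (m : EuclideanSpace ℝ (Fin d))
    (t : WithLp 2 (ℝ × EuclideanSpace ℝ (Fin d))) :
    localHuber k e (fun i => designPoint m (z i)) n (localParam m μ β n a b) ≤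
      localHuber k e (fun i => designPoint m (z i)) n t := by
  rcases eq_or_ne n 0 with rfl | hn
  · simp [localHuber]
  obtain ⟨a', b', rfl⟩ := exists_localParam_eq hn m μ β t
  rw [localHuber_localParam hy, localHuber_localParam hy]
  exact sub_le_sub_right (hfit a' b') _

/-- The linear map `(a, b) ↦ A b`. -/
def slopeMap {p : ℕ} (A : Matrix (Fin p) (Fin d) ℝ) :
    WithLp 2 (ℝ × EuclideanSpace ℝ (Fin d)) →L[ℝ] EuclideanSpace ℝ (Fin p) :=
  matApplyL A ∘L WithLp.sndL 2 ℝ ℝ (EuclideanSpace ℝ (Fin d))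

theorem slopeMap_localParam {p : ℕ} (A : Matrix (Fin p) (Fin d) ℝ)
    (m : EuclideanSpace ℝ (Fin d)) (μ : ℝ) (β : EuclideanSpace ℝ (Fin d)) (n : ℕ) (a : ℝ)
    (b : EuclideanSpace ℝ (Fin d)) :
    slopeMap A (localParam m μ β n a b) = √n • (matApply A b - matApply A β) := by
  simp only [localParam, map_smul, ← matApplyL_apply, ← map_sub]
  rfl

theorem adjoint_slopeMap_apply {p : ℕ} (A : Matrix (Fin p) (Fin d) ℝ)
    (t : EuclideanSpace ℝ (Fin p)) :
    (slopeMap A).adjoint t = WithLp.toLp 2 (0, matApply Aᵀ t) := by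
  rw [slopeMap, ContinuousLinearMap.adjoint_comp, ContinuousLinearMap.comp_apply,
    adjoint_sndL_apply, adjoint_matApplyL, matApplyL_apply]

theorem inner_adjoint_slopeMap {p : ℕ} (A : Matrix (Fin p) (Fin d) ℝ)
    {M : Matrix (Fin d) (Fin d) ℝ} (hM : IsUnit M.det) (t : EuclideanSpace ℝ (Fin p)) :
    ⟪(slopeMap A).adjoint t,
        (interceptBlock (matApplyEquiv M hM)).symm ((slopeMap A).adjoint t)⟫_ℝ =
      ⟪t, matApply (A * M⁻¹ * Aᵀ) t⟫_ℝ := by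
  have hquad : ⟪t, matApply (A * M⁻¹ * Aᵀ) t⟫_ℝ =
      ⟪matApply Aᵀ t, matApply M⁻¹ (matApply Aᵀ t)⟫_ℝ := by
    rw [← matApply_matApply, ← matApply_matApply, inner_matApply_right A t]
  rw [adjoint_slopeMap_apply, interceptBlock_symm_apply, WithLp.prod_inner_apply, hquad]
  simp [matApplyEquiv_symm_apply]

variable {S : Type*} [MeasurableSpace S] {P : Measure S}

theorem huberFactor_nonneg (P : Measure S) (k : ℝ) (ε : S → ℝ) : 0 ≤ huberFactor P k ε :=
  div_nonneg (integral_nonneg fun _ => sq_nonneg _) (sq_nonneg _)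

theorem sqrtNAsympNormal_huberFit [IsProbabilityMeasure P] {p : ℕ}
    {Z : ℕ → S → EuclideanSpace ℝ (Fin d)} {ε y : ℕ → S → ℝ} {Sz : Matrix (Fin d) (Fin d) ℝ}
    (hdesign : IsRandomDesign P Z ε) (hy : ∀ i ω, y i ω = μ + ⟪Z i ω, β⟫_ℝ + ε i ω)
    (hcov : ∀ s t, cov[fun ω => ⟪s, Z 0 ω⟫_ℝ, fun ω => ⟪t, Z 0 ω⟫_ℝ; P] = ⟪s, matApply Sz t⟫_ℝ)
    (hSz : Sz.PosDef) (hk : 0 ≤ k) (hatom : ∀ᵐ ω ∂P, |ε 0 ω| ≠ k)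
    (hpsi : ∫ ω, huberPsi k (ε 0 ω) ∂P = 0)
    (hderiv : ∫ ω, deriv (huberPsi k) (ε 0 ω) ∂P ≠ 0)
    {muhat : ℕ → S → ℝ} {bhat : ℕ → S → EuclideanSpace ℝ (Fin d)}
    (hbhat : ∀ n, AEMeasurable (bhat n) P)
    (hfit : ∀ n, ∀ᵐ ω ∂P,
      IsHuberFit k n (fun i => y i ω) (fun i => Z i ω) (muhat n ω) (bhat n ω))
    (A : Matrix (Fin p) (Fin d) ℝ) :
    SqrtNAsympNormal P (fun n ω => matApply A (bhat n ω)) (matApply A β)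
      (huberFactor P k (ε 0) • (A * Sz⁻¹ * Aᵀ)) := by
  set m := ∫ ω, Z 0 ω ∂P
  let C := interceptBlock (matApplyEquiv Sz hSz.det_pos.ne'.isUnit)
  have hmeas : ∀ n : ℕ, AEMeasurable (fun ω => √n • (matApply A (bhat n ω) - matApply A β)) P :=
    fun n => (((matApplyL A).measurable.comp_aemeasurable (hbhat n)).sub_const _).const_smul (√n)
  have hpsd : (huberFactor P k (ε 0) • (A * Sz⁻¹ * Aᵀ)).PosSemidef := by
    simpa using (hSz.inv.posSemidef.mul_mul_conjTranspose_same A).smul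
      (huberFactor_nonneg P k (ε 0))
  have hdesign' := hdesign.map (measurable_designPoint m) (memLp_designPoint hdesign.memLp_two m)
  have hlimit := hdesign'.tendstoInDistribution_map_argmin hk hatom hpsi hderiv
    (C := C) (secondMoment_designPoint hdesign.memLp_two hcov)
    (that := fun n ω => localParam m μ β n (muhat n ω) (bhat n ω))
    ((ae_all_iff.2 hfit).mono fun ω hω n => (hω n).localHuber_le (hy · ω) m) (slopeMap A)
    (by simpa only [slopeMap_localParam] using hmeas) (ν := multivariateGaussian 0 _) fun t => by
      rw [charFun_multivariateGaussian_zero hpsd, inner_adjoint_slopeMap, matApply,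
        Matrix.smul_mulVec, WithLp.toLp_smul, real_inner_smul_right, matApply]
  simpa only [SqrtNAsympNormal, slopeMap_localParam] using hlimit

end Regression

/-! ### Comparison of the covariances -/

section Comparison

variable {p u : ℕ} {Sx : Matrix (Fin p) (Fin p) ℝ} {Γ : Matrix (Fin p) (Fin u) ℝ}

theorem posDef_transpose_mul_mul (hSx : Sx.PosDef) (hΓ : Function.Injective Γ.mulVec) :
    (Γᵀ * Sx * Γ).PosDef := by
  simpa using hSx.conjTranspose_mul_mul_same hΓ

theorem posSemidef_inv_sub (hSx : Sx.PosDef) (hΓ : Function.Injective Γ.mulVec) :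
    (Sx⁻¹ - Γ * (Γᵀ * Sx * Γ)⁻¹ * Γᵀ).PosSemidef := by
  have hΩ := posDef_transpose_mul_mul hSx hΓ
  set Ω := Γᵀ * Sx * Γ with hΩ_eq
  set D := Sx⁻¹ - Γ * Ω⁻¹ * Γᵀ with hD
  have hSx_det : IsUnit Sx.det := hSx.det_pos.ne'.isUnit
  have hD_symm : Dᴴ = D := by
    rw [hD, Matrix.conjTranspose_sub, hSx.inv.isHermitian.eq]
    congr 1
    simpa using (Matrix.isHermitian_mul_mul_conjTranspose Γ hΩ.inv.isHermitian).eq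
  have hDSΓ : D * Sx * Γ = 0 := by
    rw [hD, Matrix.sub_mul, Matrix.nonsing_inv_mul _ hSx_det, Matrix.sub_mul, Matrix.one_mul,
      Matrix.mul_assoc, Matrix.mul_assoc, ← Matrix.mul_assoc Γᵀ, ← hΩ_eq, Matrix.mul_assoc,
      Matrix.nonsing_inv_mul _ hΩ.det_pos.ne'.isUnit, Matrix.mul_one, sub_self]
  have hDSD : D * Sx * D = D := by
    nth_rewrite 2 [hD]
    rw [Matrix.mul_sub, Matrix.mul_assoc, Matrix.mul_nonsing_inv _ hSx_det, Matrix.mul_one,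
      ← Matrix.mul_assoc, ← Matrix.mul_assoc, hDSΓ, Matrix.zero_mul, Matrix.zero_mul, sub_zero]
  simpa only [hD_symm, hDSD] using hSx.posSemidef.mul_mul_conjTranspose_same D

theorem mul_ne_inv_of_lt (hSx : Sx.PosDef) (hup : u < p) (B : Matrix (Fin u) (Fin p) ℝ) :
    Γ * B ≠ Sx⁻¹ := fun heq => by
  have hrank : (Γ * B).rank = p := by
    rw [heq, Matrix.rank_of_isUnit _ hSx.inv.isUnit, Fintype.card_fin]
  exact hup.not_ge (hrank ▸ (Matrix.rank_mul_le_left Γ B).trans (Γ.rank_le_width))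

end Comparison

/-! ### The envelope parametrization -/

section Envelope

variable {p u w : ℕ}

theorem transpose_mul_eq_zero_of_colSpan_orthogonal {Γ : Matrix (Fin p) (Fin u) ℝ}
    {Γ₀ : Matrix (Fin p) (Fin w) ℝ} (h : colSpan Γ ⟂ colSpan Γ₀) : Γᵀ * Γ₀ = 0 := by
  refine Matrix.ext fun i j => ?_
  have hinner := h.inner_eq (Submodule.subset_span ⟨i, rfl⟩) (Submodule.subset_span ⟨j, rfl⟩)
  simpa [Matrix.mul_apply, PiLp.inner_apply, mul_comm] using hinner

namespace EnvelopedHuberModel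

variable {S : Type*} [MeasurableSpace S] {P : Measure S} {k : ℝ}
  {X : ℕ → S → EuclideanSpace ℝ (Fin p)} {ε y : ℕ → S → ℝ} {μ : ℝ}
  {β μx : EuclideanSpace ℝ (Fin p)} {Sx : Matrix (Fin p) (Fin p) ℝ}
  {Γ : Matrix (Fin p) (Fin u) ℝ} {Γ₀ : Matrix (Fin p) (Fin (p - u)) ℝ}
  {η : EuclideanSpace ℝ (Fin u)} {Ω : Matrix (Fin u) (Fin u) ℝ}
  {Ω₀ : Matrix (Fin (p - u)) (Fin (p - u)) ℝ}

theorem isRandomDesign (h : EnvelopedHuberModel P k X ε y μ β μx Sx Γ Γ₀ η Ω Ω₀)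
    (hindep : IndepFun (X 0) (ε 0) P) : IsRandomDesign P X ε :=
  ⟨h.indep, h.ident, h.memLp_two, hindep⟩

theorem integral_huberPsi [IsFiniteMeasure P]
    (h : EnvelopedHuberModel P k X ε y μ β μx Sx Γ Γ₀ η Ω Ω₀) :
    ∫ ω, huberPsi k (ε 0 ω) ∂P = 0 := by
  rw [← integral_condExp (h.measurable_X 0).comap_le, integral_congr_ae h.condExp_psi]
  exact integral_zero _ _

theorem injective_mulVec (h : EnvelopedHuberModel P k X ε y μ β μx Sx Γ Γ₀ η Ω Ω₀) :
    Function.Injective Γ.mulVec := fun a b hab => by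
  simpa [h.semiorthogonal] using congrArg Γᵀ.mulVec hab

theorem transpose_mul_mul (h : EnvelopedHuberModel P k X ε y μ β μx Sx Γ Γ₀ η Ω Ω₀) :
    Γᵀ * Sx * Γ = Ω := by
  have horth : Γᵀ * Γ₀ = 0 := transpose_mul_eq_zero_of_colSpan_orthogonal <| by
    rw [h.span_eq, h.span_eq₀]
    exact Submodule.isOrtho_orthogonal_right _
  rw [h.cov_decomp, Matrix.mul_add, Matrix.mul_assoc Γ₀, ← Matrix.mul_assoc _ Γ₀, horth,
    Matrix.zero_mul, add_zero, ← Matrix.mul_assoc, ← Matrix.mul_assoc, h.semiorthogonal,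
    Matrix.one_mul, Matrix.mul_assoc, h.semiorthogonal, Matrix.mul_one]

end EnvelopedHuberModel

end Envelope

end

theorem proposition2_general {S : Type*} [MeasurableSpace S] {P : Measure S}
    [IsProbabilityMeasure P] {p u : ℕ} {k : ℝ} (hk : 0 ≤ k)
    {X : ℕ → S → EuclideanSpace ℝ (Fin p)} {ε y : ℕ → S → ℝ} {μ : ℝ}
    {β : EuclideanSpace ℝ (Fin p)} {Sx : Matrix (Fin p) (Fin p) ℝ}
    {Γ : Matrix (Fin p) (Fin u) ℝ} {η : EuclideanSpace ℝ (Fin u)} {Ω : Matrix (Fin u) (Fin u) ℝ}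
    (hdesign : IsRandomDesign P X ε) (hy : ∀ i ω, y i ω = μ + inner ℝ (X i ω) β + ε i ω)
    (hcov : ∀ a b, cov[fun ω => X 0 ω a, fun ω => X 0 ω b; P] = Sx a b) (hSx : Sx.PosDef)
    (hΓ : Function.Injective Γ.mulVec) (hβ : β = matApply Γ η) (hΩ : Γᵀ * Sx * Γ = Ω)
    (hpsi : ∫ ω, huberPsi k (ε 0 ω) ∂P = 0) (hatom : ∀ᵐ ω ∂P, |ε 0 ω| ≠ k)
    (hderiv : ∫ ω, deriv (huberPsi k) (ε 0 ω) ∂P ≠ 0)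
    {muhat : ℕ → S → ℝ} {etahat : ℕ → S → EuclideanSpace ℝ (Fin u)}
    (hetahat : ∀ n, AEMeasurable (etahat n) P)
    (hfit : ∀ n, ∀ᵐ ω ∂P,
      IsHuberFit k n (fun i => y i ω) (fun i => matApply Γᵀ (X i ω)) (muhat n ω) (etahat n ω)) :
    Ω.PosDef ∧
    SqrtNAsympNormal P (fun n ω => matApply Γ (etahat n ω)) β
      (huberFactor P k (ε 0) • (Γ * Ω⁻¹ * Γᵀ)) ∧
    (∀ (muhat_h : ℕ → S → ℝ) (betahat_h : ℕ → S → EuclideanSpace ℝ (Fin p)),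
      (∀ n, AEMeasurable (betahat_h n) P) →
      (∀ n, ∀ᵐ ω ∂P,
        IsHuberFit k n (fun i => y i ω) (fun i => X i ω) (muhat_h n ω) (betahat_h n ω)) →
      SqrtNAsympNormal P betahat_h β (huberFactor P k (ε 0) • Sx⁻¹)) ∧
    (huberFactor P k (ε 0) • Sx⁻¹ - huberFactor P k (ε 0) • (Γ * Ω⁻¹ * Γᵀ)).PosSemidef ∧
    (u < p → ∫ ω, huberPsi k (ε 0 ω) ^ 2 ∂P ≠ 0 →
      huberFactor P k (ε 0) • (Γ * Ω⁻¹ * Γᵀ) ≠ huberFactor P k (ε 0) • Sx⁻¹) := by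
  subst hβ hΩ
  have hcovX := covariance_inner_inner hdesign.memLp_two hcov
  have hΩ := posDef_transpose_mul_mul hSx hΓ
  refine ⟨hΩ, ?_, ?_, ?_, ?_⟩
  · have hdesign' := hdesign.map (matApplyL Γᵀ).measurable
      ((matApplyL Γᵀ).comp_memLp' hdesign.memLp_two)
    refine sqrtNAsympNormal_huberFit (μ := μ) hdesign' (fun i ω => ?_) (fun s t => ?_) hΩ hk hatom
      hpsi hderiv hetahat hfit Γ
    · rw [hy, inner_matApply_right, matApplyL_apply]
    · simp only [matApplyL_apply, inner_matApply_right Γᵀ, Matrix.transpose_transpose]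
      rw [hcovX, inner_matApply_left, matApply_matApply, matApply_matApply]
  · intro muhat_h betahat_h hmeas hfit_h
    simpa [matApply_one] using sqrtNAsympNormal_huberFit hdesign hy hcovX hSx hk hatom hpsi hderiv
      hmeas hfit_h (1 : Matrix (Fin p) (Fin p) ℝ)
  · rw [← smul_sub]
    exact (posSemidef_inv_sub hSx hΓ).smul (huberFactor_nonneg P k (ε 0))
  · intro hup hpsi_sq heq
    refine mul_ne_inv_of_lt (Γ := Γ) hSx hup ((Γᵀ * Sx * Γ)⁻¹ * Γᵀ) ?_
    rw [← Matrix.mul_assoc]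
    exact smul_right_injective _ (div_ne_zero hpsi_sq (pow_ne_zero 2 hderiv)) heq

theorem proposition2 {S : Type*} [MeasurableSpace S] (P : Measure S) [IsProbabilityMeasure P]
    {p u : ℕ} (k : ℝ) (hk : 0 < k)
    (X : ℕ → S → EuclideanSpace ℝ (Fin p)) (ε y : ℕ → S → ℝ)
    (μ : ℝ) (β μx : EuclideanSpace ℝ (Fin p)) (Sx : Matrix (Fin p) (Fin p) ℝ)
    (Γ : Matrix (Fin p) (Fin u) ℝ) (Γ₀ : Matrix (Fin p) (Fin (p - u)) ℝ)
    (η : EuclideanSpace ℝ (Fin u)) (Ω : Matrix (Fin u) (Fin u) ℝ)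
    (Ω₀ : Matrix (Fin (p - u)) (Fin (p - u)) ℝ)
    (hmodel : EnvelopedHuberModel P k X ε y μ β μx Sx Γ Γ₀ η Ω Ω₀)
    (hindep : IndepFun (X 0) (ε 0) P)
    -- `ψ'(ε)` is almost surely defined, and its expectation is nonzero
    (hatom : ∀ᵐ ω ∂P, |ε 0 ω| ≠ k)
    (hderiv : ∫ ω, deriv (huberPsi k) (ε 0 ω) ∂P ≠ 0)
    -- the Huber regression of `y` on `Γᵀ x`
    (muhat : ℕ → S → ℝ) (etahat : ℕ → S → EuclideanSpace ℝ (Fin u))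
    (hetahat : ∀ n, AEMeasurable (etahat n) P)
    (hfit : ∀ n, ∀ᵐ ω ∂P,
      IsHuberFit k n (fun i => y i ω) (fun i => matApply Γᵀ (X i ω)) (muhat n ω) (etahat n ω)) :
    Ω.PosDef ∧
    SqrtNAsympNormal P (fun n ω => matApply Γ (etahat n ω)) β
      (huberFactor P k (ε 0) • (Γ * Ω⁻¹ * Γᵀ)) ∧
    -- the Huber regression of `y` on `x`
    (∀ (muhat_h : ℕ → S → ℝ) (betahat_h : ℕ → S → EuclideanSpace ℝ (Fin p)),
      (∀ n, AEMeasurable (betahat_h n) P) →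
      (∀ n, ∀ᵐ ω ∂P,
        IsHuberFit k n (fun i => y i ω) (fun i => X i ω) (muhat_h n ω) (betahat_h n ω)) →
      SqrtNAsympNormal P betahat_h β (huberFactor P k (ε 0) • Sx⁻¹)) ∧
    (huberFactor P k (ε 0) • Sx⁻¹ - huberFactor P k (ε 0) • (Γ * Ω⁻¹ * Γᵀ)).PosSemidef ∧
    (u < p → ∫ ω, huberPsi k (ε 0 ω) ^ 2 ∂P ≠ 0 →
      huberFactor P k (ε 0) • (Γ * Ω⁻¹ * Γᵀ) ≠ huberFactor P k (ε 0) • Sx⁻¹) :=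
  proposition2_general hk.le (hmodel.isRandomDesign hindep) hmodel.response hmodel.cov_eq
    hmodel.posDef_cov hmodel.injective_mulVec hmodel.slope_eq hmodel.transpose_mul_mul
    hmodel.integral_huberPsi hatom hderiv hetahat hfit
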